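/- Let $G$ be a group, $\mathbb K$ a field, and let $V=\bigoplus_{g\in G}V_g$ and $W=\bigoplus_{g\in G}W_g$ be Yetter-Drinfeld modules over $\mathbb K G$ (that is, $G$-graded $\mathbb K G$-modules with $hV_g\subseteq V_{hgh^{-1}}$ and $hW_g\subseteq W_{hgh^{-1}}$ for all $g,h\in G$), of arbitrary dimension. Write $\mathrm{supp}\,V=\{g\in G: V_g\neq 0\}$; it is stable under conjugation by $G$, and is viewed as a quandle via $r\triangleright s=rsr^{-1}$. Let $\mathrm{Inn}(\mathrm{supp}\,V)$ be the group of permutations of $\mathrm{supp}\,V$ generated by the maps $s\mapsto r\triangleright s$, $r\in \mathrm{supp}\,V$; $\mathrm{supp}\,V$ is called indecomposable if this group acts transitively on it. In the Nichols algebra $\mathcal B(V\oplus W)$, put $(\mathrm{ad}\,v)(b)=vb-(g\cdot b)v$ for $v\in V_g$, $b\in\mathcal B(V\oplus W)$, extended linearly to all $v\in V$; let $(\mathrm{ad}\,V)^0(W)=W$ and let $(\mathrm{ad}\,V)^{n+1}(W)$ be the linear span of all $(\mathrm{ad}\,v)(b)$ with $v\in V$, $b\in(\mathrm{ad}\,V)^n(W)$.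 Let $m\ge 1$ and assume that the following hold. (1) Either $\mathrm{supp}\,V$ is indecomposable, or $\mathrm{supp}\,V=Y_1\sqcup Y_2$ with two $\mathrm{Inn}(\mathrm{supp}\,V)$-orbits $Y_1,Y_2$ such that $xY_1x^{-1}=Y_2$ and $xY_2x^{-1}=Y_1$ for all $x\in\mathrm{supp}\,W$. (2) $(\mathrm{ad}\,V)^m(W)\ne 0$ and $(\mathrm{ad}\,V)^{m+1}(W)=0$. Then $\mathrm{supp}\,V$ is finite. Moreover, $|\mathrm{supp}\,V|\le 2m-1$ if $rs=sr$ for all $r\in\mathrm{supp}\,V$ and $s\in\mathrm{supp}\,W$, and $|\mathrm{supp}\,V|\le 2m$ otherwise. -/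

import Mathlib

open scoped TensorProduct DirectSum

/-- A Yetter-Drinfeld module structure over the group `G` on the `k`-vector space `V`: a linear
action of `G` on `V` and a `G`-grading `V = ⨁ V_g` such that `h V_g ⊆ V_{h g h⁻¹}`. -/
structure YetterDrinfeld (k G V : Type*) [Field k] [Group G] [AddCommGroup V] [Module k V] where
  ρ : Representation k G V
  comp : G → Submodule k V
  isInternal : letI := Classical.decEq G; DirectSum.IsInternal comp
  map_mem : ∀ (h g : G) (v : V), v ∈ comp g → ρ h v ∈ comp (h * g * h⁻¹)

namespace YetterDrinfeld

section Basic

variable {k G V W N : Type*} [Field k] [Group G] [AddCommGroup V] [Module k V]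
  [AddCommGroup W] [Module k W] [AddCommGroup N] [Module k N]

/-- The support `{g ∈ G | V_g ≠ 0}`. -/
def supp (A : YetterDrinfeld k G V) : Set G := {g | A.comp g ≠ ⊥}

theorem ρ_inv_ρ (A : YetterDrinfeld k G V) (h : G) (v : V) : A.ρ h⁻¹ (A.ρ h v) = v := by
  rw [← Module.End.mul_apply, ← map_mul, inv_mul_cancel, map_one, Module.End.one_apply]

theorem conj_mem_supp (A : YetterDrinfeld k G V) (h : G) {g : G} (hg : g ∈ A.supp) :
    h * g * h⁻¹ ∈ A.supp := by
  obtain ⟨v, hv, hv0⟩ := (Submodule.ne_bot_iff _).1 hg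
  refine (Submodule.ne_bot_iff _).2 ⟨A.ρ h v, A.map_mem h g v hv, fun h0 => hv0 ?_⟩
  rw [← A.ρ_inv_ρ h v, h0, map_zero]

/-- Conjugation `x ▷ r = x r x⁻¹` by an arbitrary `x ∈ G`, as a map of the support to itself. -/
def conjSupp (A : YetterDrinfeld k G V) (x : G) (r : A.supp) : A.supp :=
  ⟨x * r * x⁻¹, A.conj_mem_supp x r.2⟩

/-- The support is a union of conjugacy classes, hence a quandle under conjugation. -/
instance quandleSupp (A : YetterDrinfeld k G V) : Quandle A.supp where
  act r s := A.conjSupp r s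
  self_distrib := by
    intro x y z
    apply Subtype.ext
    simp only [conjSupp]
    group
  invAct r s := A.conjSupp (r : G)⁻¹ s
  left_inv x y := by
    apply Subtype.ext
    simp only [conjSupp]
    group
  right_inv x y := by
    apply Subtype.ext
    simp only [conjSupp]
    group
  fix := by
    intro x
    apply Subtype.ext
    simp only [conjSupp]
    group

open Classical in
/-- For a family of linear maps `F g : V → N`, the linear map `v ↦ ∑ g, F g (v_g)`, where `v_g` is
the homogeneous component of `v` of degree `g`. -/
noncomputable def sumComp (A : YetterDrinfeld k G V) (F : G → V →ₗ[k] N) : V →ₗ[k] N :=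
  DirectSum.toModule k G N (fun g => F g ∘ₗ (A.comp g).subtype) ∘ₗ
    (LinearEquiv.ofBijective (DirectSum.coeLinearMap A.comp) A.isInternal).symm.toLinearMap

theorem sumComp_of_mem (A : YetterDrinfeld k G V) (F : G → V →ₗ[k] N) {g : G} {v : V}
    (hv : v ∈ A.comp g) : A.sumComp F v = F g v := by
  classical
  have h : (LinearEquiv.ofBijective (DirectSum.coeLinearMap A.comp) A.isInternal).symm v
      = DirectSum.lof k G (fun g => A.comp g) g ⟨v, hv⟩ := by
    rw [LinearEquiv.symm_apply_eq]
    exact (DirectSum.coeLinearMap_lof A.comp g ⟨v, hv⟩).symm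
  simp only [sumComp, LinearMap.comp_apply, LinearEquiv.coe_coe]
  rw [h, DirectSum.toModule_lof]
  simp

theorem iSup_comp (A : YetterDrinfeld k G V) : iSup A.comp = ⊤ := by
  classical
  exact A.isInternal.submodule_iSup_eq_top

theorem induction_comp (A : YetterDrinfeld k G V) {p : V → Prop} (v : V)
    (mem : ∀ g, ∀ x ∈ A.comp g, p x) (zero : p 0) (add : ∀ x y, p x → p y → p (x + y)) : p v :=
  Submodule.iSup_induction A.comp (motive := p)
    (by rw [A.iSup_comp]; exact Submodule.mem_top) mem zero add

/-- The direct sum `V ⊕ W` of Yetter-Drinfeld modules. -/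
def prod (A : YetterDrinfeld k G V) (B : YetterDrinfeld k G W) : YetterDrinfeld k G (V × W) where
  ρ :=
    { toFun := fun g => (A.ρ g).prodMap (B.ρ g)
      map_one' := by rw [map_one, map_one]; rfl
      map_mul' := fun g h => by rw [map_mul, map_mul]; rfl }
  comp g := (A.comp g).prod (B.comp g)
  isInternal := by
    classical
    have hsup : iSup (fun g => (A.comp g).prod (B.comp g)) = ⊤ := by
      rw [eq_top_iff]
      rintro ⟨v, w⟩ -
      have h1 : ((v, 0) : V × W) ∈ iSup (fun g => (A.comp g).prod (B.comp g)) := by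
        refine A.induction_comp (p := fun v => ((v, 0) : V × W) ∈ _) v ?_ ?_ ?_
        · intro g x hx
          exact Submodule.mem_iSup_of_mem g ⟨hx, Submodule.zero_mem _⟩
        · exact Submodule.zero_mem _
        · intro x y hx hy
          simpa using Submodule.add_mem _ hx hy
      have h2 : ((0, w) : V × W) ∈ iSup (fun g => (A.comp g).prod (B.comp g)) := by
        refine B.induction_comp (p := fun w => ((0, w) : V × W) ∈ _) w ?_ ?_ ?_
        · intro g x hx
          exact Submodule.mem_iSup_of_mem g ⟨Submodule.zero_mem _, hx⟩
        · exact Submodule.zero_mem _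
        · intro x y hx hy
          simpa using Submodule.add_mem _ hx hy
      simpa using Submodule.add_mem _ h1 h2
    have hind : iSupIndep (fun g => (A.comp g).prod (B.comp g)) := by
      intro g
      have hA := A.isInternal.submodule_iSupIndep g
      have hB := B.isInternal.submodule_iSupIndep g
      rw [Submodule.disjoint_def] at hA hB ⊢
      rintro ⟨v, w⟩ ⟨hv, hw⟩ h
      have hle : (⨆ j, ⨆ (_ : j ≠ g), (A.comp j).prod (B.comp j)) ≤
          (⨆ j, ⨆ (_ : j ≠ g), A.comp j).prod (⨆ j, ⨆ (_ : j ≠ g), B.comp j) :=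
        iSup₂_le fun j hj => Submodule.prod_mono (le_iSup₂_of_le j hj le_rfl)
          (le_iSup₂_of_le j hj le_rfl)
      have h' := hle h
      exact Prod.ext (hA v hv h'.1) (hB w hw h'.2)
    exact DirectSum.isInternal_submodule_of_iSupIndep_of_iSup_eq_top hind hsup
  map_mem h g v hv := ⟨A.map_mem h g v.1 hv.1, B.map_mem h g v.2 hv.2⟩

/-- The braiding `c : V ⊗ V → V ⊗ V`, `c (x ⊗ y) = g y ⊗ x` for `x ∈ V_g`. -/
noncomputable def braiding (A : YetterDrinfeld k G V) : V ⊗[k] V →ₗ[k] V ⊗[k] V :=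
  TensorProduct.lift (A.sumComp fun g => (TensorProduct.mk k V V).flip.compl₂ (A.ρ g))

theorem braiding_tmul (A : YetterDrinfeld k G V) {g : G} {x : V} (hx : x ∈ A.comp g) (y : V) :
    A.braiding (x ⊗ₜ y) = A.ρ g y ⊗ₜ x := by
  simp [braiding, A.sumComp_of_mem _ hx]

end Basic

section TensorPower

variable {k G V : Type*} [Field k] [Group G] [AddCommGroup V] [Module k V]

/-- The isomorphism `V ⊗ V^{⊗ n} ≃ V^{⊗ (n+1)}`. -/
noncomputable def cons (k V : Type*) [Field k] [AddCommGroup V] [Module k V] (n : ℕ) :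
    V ⊗[k] (⨂[k]^n V) ≃ₗ[k] ⨂[k]^(n + 1) V :=
  (TensorProduct.congr (PiTensorProduct.subsingletonEquiv (0 : Fin 1)).symm
      (LinearEquiv.refl k (⨂[k]^n V))).trans
    ((TensorPower.mulEquiv (R := k) (M := V) (n := 1) (m := n)).trans
      (TensorPower.cast k V (Nat.add_comm 1 n)))

theorem cons_tmul_tprod (n : ℕ) (x : V) (v : Fin n → V) :
    cons k V n (x ⊗ₜ PiTensorProduct.tprod k v) =
      PiTensorProduct.tprod k (Fin.cons x v : Fin (n + 1) → V) := by
  have h1 : (PiTensorProduct.subsingletonEquiv (R := k) (s := fun _ : Fin 1 => V)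
      (0 : Fin 1)).symm x =
      PiTensorProduct.tprod k (fun _ : Fin 1 => x) :=
    PiTensorProduct.subsingletonEquiv_symm_apply' (0 : Fin 1) x
  simp only [cons, LinearEquiv.trans_apply, TensorProduct.congr_tmul, LinearEquiv.refl_apply]
  rw [h1]
  have h2 := TensorPower.tprod_mul_tprod (R := k) (fun _ : Fin 1 => x) v
  rw [TensorPower.gMul_def] at h2
  rw [h2, TensorPower.cast_tprod]
  congr 1
  funext i
  refine Fin.cases ?_ (fun j => ?_) i
  · simp [Fin.append, Fin.addCases]
  · simp [Fin.append, Fin.addCases]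
    rfl

/-- For an endomorphism `f` of `V^{⊗ n}`, the endomorphism `id ⊗ f` of `V^{⊗ (n+1)}`. -/
noncomputable def idTensor {n : ℕ} (f : (⨂[k]^n V) →ₗ[k] ⨂[k]^n V) :
    (⨂[k]^(n + 1) V) →ₗ[k] ⨂[k]^(n + 1) V :=
  (cons k V n).toLinearMap ∘ₗ f.lTensor V ∘ₗ (cons k V n).symm.toLinearMap

/-- The endomorphism `c_{1,2} = c ⊗ id` of `V^{⊗ (n+2)}`. -/
noncomputable def braidFirst (A : YetterDrinfeld k G V) (n : ℕ) :
    (⨂[k]^(n + 2) V) →ₗ[k] ⨂[k]^(n + 2) V :=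
  let e : (V ⊗[k] V) ⊗[k] (⨂[k]^n V) ≃ₗ[k] ⨂[k]^(n + 2) V :=
    (TensorProduct.assoc k V V (⨂[k]^n V)).trans
      ((TensorProduct.congr (LinearEquiv.refl k V) (cons k V n)).trans (cons k V (n + 1)))
  e.toLinearMap ∘ₗ A.braiding.rTensor (⨂[k]^n V) ∘ₗ e.symm.toLinearMap

/-- The endomorphism `id + c_{1,2} + c_{2,3} c_{1,2} + ⋯ + c_{n,n+1} ⋯ c_{2,3} c_{1,2}` of
`V^{⊗ (n+1)}`. -/
noncomputable def shuffle (A : YetterDrinfeld k G V) :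
    (n : ℕ) → (⨂[k]^(n + 1) V) →ₗ[k] ⨂[k]^(n + 1) V
  | 0 => LinearMap.id
  | n + 1 => LinearMap.id + idTensor (shuffle A n) ∘ₗ A.braidFirst n

/-- The quantum symmetrizer `S_n = ∑_{σ ∈ Sym(n)} c_σ` on `V^{⊗ n}`, through its factorization
`S_{n+1} = (id + c_{1,2} + c_{2,3} c_{1,2} + ⋯ + c_{n,n+1} ⋯ c_{1,2}) (id ⊗ S_n)`. -/
noncomputable def quantumSymm (A : YetterDrinfeld k G V) :
    (n : ℕ) → (⨂[k]^n V) →ₗ[k] ⨂[k]^n V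
  | 0 => LinearMap.id
  | n + 1 => A.shuffle n ∘ₗ idTensor (quantumSymm A n)

/-- The diagonal action of `h ∈ G` on `V^{⊗ n}`. -/
noncomputable def powAct (A : YetterDrinfeld k G V) (h : G) (n : ℕ) :
    (⨂[k]^n V) →ₗ[k] ⨂[k]^n V :=
  PiTensorProduct.map fun _ => A.ρ h

theorem powAct_cons (A : YetterDrinfeld k G V) (h : G) (n : ℕ) (x : V ⊗[k] (⨂[k]^n V)) :
    A.powAct h (n + 1) (cons k V n x) =
      cons k V n (TensorProduct.map (A.ρ h) (A.powAct h n) x) := by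
  have key : A.powAct h (n + 1) ∘ₗ (cons k V n).toLinearMap =
      (cons k V n).toLinearMap ∘ₗ TensorProduct.map (A.ρ h) (A.powAct h n) := by
    refine TensorProduct.ext (LinearMap.ext fun y => PiTensorProduct.ext
      (MultilinearMap.ext fun v => ?_))
    change A.powAct h (n + 1) (cons k V n (y ⊗ₜ PiTensorProduct.tprod k v)) =
      cons k V n (A.ρ h y ⊗ₜ A.powAct h n (PiTensorProduct.tprod k v))
    simp only [powAct, cons_tmul_tprod, PiTensorProduct.map_tprod]
    congr 1
    funext i
    refine Fin.cases ?_ (fun j => ?_) i <;> simp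
  exact LinearMap.congr_fun key x

theorem powAct_idTensor (A : YetterDrinfeld k G V) (h : G) {n : ℕ}
    (f : (⨂[k]^n V) →ₗ[k] ⨂[k]^n V) (hf : ∀ t, A.powAct h n (f t) = f (A.powAct h n t))
    (t : ⨂[k]^(n + 1) V) :
    A.powAct h (n + 1) (idTensor f t) = idTensor f (A.powAct h (n + 1) t) := by
  obtain ⟨x, rfl⟩ := (cons k V n).surjective t
  simp only [idTensor, LinearMap.comp_apply, LinearEquiv.coe_coe, powAct_cons,
    LinearEquiv.symm_apply_apply]
  congr 1
  induction x with
  | zero => simp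
  | add x y hx hy => simp only [map_add, hx, hy]
  | tmul x y => simp [hf]

theorem map_braiding (A : YetterDrinfeld k G V) (h : G) (x : V ⊗[k] V) :
    TensorProduct.map (A.ρ h) (A.ρ h) (A.braiding x) =
      A.braiding (TensorProduct.map (A.ρ h) (A.ρ h) x) := by
  induction x with
  | zero => simp
  | add x y hx hy => simp only [map_add, hx, hy]
  | tmul x y =>
    refine A.induction_comp (p := fun x => TensorProduct.map (A.ρ h) (A.ρ h)
      (A.braiding (x ⊗ₜ y)) = A.braiding (TensorProduct.map (A.ρ h) (A.ρ h) (x ⊗ₜ y))) x ?_ ?_ ?_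
    · intro g x hx
      rw [A.braiding_tmul hx, TensorProduct.map_tmul, TensorProduct.map_tmul,
        A.braiding_tmul (A.map_mem h g x hx)]
      congr 1
      simp only [← Module.End.mul_apply, ← map_mul]
      simp
    · simp
    · intro x x' hx hx'
      simp only [TensorProduct.add_tmul, map_add, hx, hx']

theorem powAct_braidFirst (A : YetterDrinfeld k G V) (h : G) (n : ℕ) (t : ⨂[k]^(n + 2) V) :
    A.powAct h (n + 2) (A.braidFirst n t) = A.braidFirst n (A.powAct h (n + 2) t) := by
  let e : (V ⊗[k] V) ⊗[k] (⨂[k]^n V) ≃ₗ[k] ⨂[k]^(n + 2) V :=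
    (TensorProduct.assoc k V V (⨂[k]^n V)).trans
      ((TensorProduct.congr (LinearEquiv.refl k V) (cons k V n)).trans (cons k V (n + 1)))
  have he : ∀ x, A.powAct h (n + 2) (e x) =
      e (TensorProduct.map (TensorProduct.map (A.ρ h) (A.ρ h)) (A.powAct h n) x) := by
    intro x
    induction x with
    | zero => simp
    | add x y hx hy => simp only [map_add, hx, hy]
    | tmul x z =>
      induction x with
      | zero => simp
      | add x y hx hy => simp only [TensorProduct.add_tmul, map_add, hx, hy]
      | tmul x y => simp [e, powAct_cons]
  obtain ⟨x, rfl⟩ := e.surjective t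
  change A.powAct h (n + 2) (e (A.braiding.rTensor _ (e.symm (e x)))) =
    e (A.braiding.rTensor _ (e.symm (A.powAct h (n + 2) (e x))))
  rw [he, he, LinearEquiv.symm_apply_apply, LinearEquiv.symm_apply_apply]
  congr 1
  induction x with
  | zero => simp
  | add x y hx hy => simp only [map_add, hx, hy]
  | tmul x z => simp [map_braiding]

theorem powAct_shuffle (A : YetterDrinfeld k G V) (h : G) :
    ∀ (n : ℕ) (t : ⨂[k]^(n + 1) V),
      A.powAct h (n + 1) (A.shuffle n t) = A.shuffle n (A.powAct h (n + 1) t)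
  | 0, t => rfl
  | n + 1, t => by
    simp only [shuffle, LinearMap.add_apply, LinearMap.id_apply, LinearMap.comp_apply, map_add]
    rw [A.powAct_idTensor h _ (powAct_shuffle A h n), A.powAct_braidFirst]

theorem powAct_quantumSymm (A : YetterDrinfeld k G V) (h : G) :
    ∀ (n : ℕ) (t : ⨂[k]^n V),
      A.powAct h n (A.quantumSymm n t) = A.quantumSymm n (A.powAct h n t)
  | 0, t => rfl
  | n + 1, t => by
    simp only [quantumSymm, LinearMap.comp_apply]
    rw [A.powAct_shuffle, A.powAct_idTensor h _ (powAct_quantumSymm A h n)]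

end TensorPower

section Nichols

variable {k G V W : Type*} [Field k] [Group G] [AddCommGroup V] [Module k V]
  [AddCommGroup W] [Module k W]

/-- The defining relations of the Nichols algebra: `a = 0` for all `a ∈ ker S_n ⊆ V^{⊗ n}`. -/
inductive NicholsRel (A : YetterDrinfeld k G V) : TensorAlgebra k V → TensorAlgebra k V → Prop
  | of (n : ℕ) (t : ⨂[k]^n V) (ht : A.quantumSymm n t = 0) :
      NicholsRel A (TensorPower.toTensorAlgebra t) 0

/-- The Nichols algebra `𝓑(V) = T(V) / ⨁ ker S_n`. -/
def Nichols (A : YetterDrinfeld k G V) : Type _ := RingQuot A.NicholsRel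

noncomputable instance (A : YetterDrinfeld k G V) : Ring A.Nichols :=
  inferInstanceAs (Ring (RingQuot A.NicholsRel))

noncomputable instance (A : YetterDrinfeld k G V) : Algebra k A.Nichols :=
  inferInstanceAs (Algebra k (RingQuot A.NicholsRel))

/-- The quotient map `T(V) → 𝓑(V)`. -/
noncomputable def nicholsMk (A : YetterDrinfeld k G V) : TensorAlgebra k V →ₐ[k] A.Nichols :=
  RingQuot.mkAlgHom k A.NicholsRel

theorem nicholsMk_eq_zero (A : YetterDrinfeld k G V) {n : ℕ} (t : ⨂[k]^n V)
    (ht : A.quantumSymm n t = 0) : A.nicholsMk (TensorPower.toTensorAlgebra t) = 0 :=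
  (RingQuot.mkAlgHom_rel k (NicholsRel.of n t ht)).trans (map_zero (A.nicholsMk))

/-- The universal property of `𝓑(V)` as a quotient of `T(V)`. -/
noncomputable def nicholsLift (A : YetterDrinfeld k G V) {R : Type*} [Semiring R] [Algebra k R]
    (f : TensorAlgebra k V →ₐ[k] R)
    (hf : ∀ (n : ℕ) (t : ⨂[k]^n V), A.quantumSymm n t = 0 →
      f (TensorPower.toTensorAlgebra t) = 0) : A.Nichols →ₐ[k] R :=
  RingQuot.liftAlgHom k ⟨f, by
    rintro _ _ ⟨n, t, ht⟩
    rw [hf n t ht, map_zero]⟩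

theorem nicholsLift_mk (A : YetterDrinfeld k G V) {R : Type*} [Semiring R] [Algebra k R]
    (f : TensorAlgebra k V →ₐ[k] R)
    (hf : ∀ (n : ℕ) (t : ⨂[k]^n V), A.quantumSymm n t = 0 →
      f (TensorPower.toTensorAlgebra t) = 0) (a : TensorAlgebra k V) :
    A.nicholsLift f hf (A.nicholsMk a) = f a :=
  RingQuot.liftAlgHom_mkAlgHom_apply k f _ a

/-- The canonical map `V → 𝓑(V)`. -/
noncomputable def nicholsι (A : YetterDrinfeld k G V) : V →ₗ[k] A.Nichols :=
  A.nicholsMk.toLinearMap ∘ₗ TensorAlgebra.ι k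

/-- The action of `h ∈ G` on the tensor algebra, by the algebra map that extends `v ↦ h v`. -/
noncomputable def tensorAct (A : YetterDrinfeld k G V) (h : G) :
    TensorAlgebra k V →ₐ[k] TensorAlgebra k V :=
  TensorAlgebra.lift k (TensorAlgebra.ι k ∘ₗ A.ρ h)

theorem tensorAct_toTensorAlgebra (A : YetterDrinfeld k G V) (h : G) {n : ℕ}
    (t : ⨂[k]^n V) :
    A.tensorAct h (TensorPower.toTensorAlgebra t) =
      TensorPower.toTensorAlgebra (A.powAct h n t) := by
  have key : (A.tensorAct h).toLinearMap ∘ₗ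
      (TensorPower.toTensorAlgebra : (⨂[k]^n V) →ₗ[k] TensorAlgebra k V) =
      TensorPower.toTensorAlgebra ∘ₗ A.powAct h n := by
    refine PiTensorProduct.ext (MultilinearMap.ext fun v => ?_)
    simp [powAct, tensorAct, TensorPower.toTensorAlgebra_tprod, TensorAlgebra.tprod_apply, map_list_prod,
      List.map_ofFn, Function.comp_def]
  exact LinearMap.congr_fun key t

/-- The action of `h ∈ G` on the Nichols algebra, by the algebra map that extends `v ↦ h v`. -/
noncomputable def nicholsAct (A : YetterDrinfeld k G V) (h : G) : A.Nichols →ₐ[k] A.Nichols :=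
  A.nicholsLift (A.nicholsMk.comp (A.tensorAct h)) fun n t ht => by
    rw [AlgHom.comp_apply, tensorAct_toTensorAlgebra]
    exact A.nicholsMk_eq_zero _ (by rw [← A.powAct_quantumSymm, ht, map_zero])

theorem nicholsAct_ι (A : YetterDrinfeld k G V) (h : G) (v : V) :
    A.nicholsAct h (A.nicholsι v) = A.nicholsι (A.ρ h v) := by
  simp [nicholsAct, nicholsι, nicholsLift_mk, tensorAct]

/-- The braided adjoint action of `V` on the Nichols algebra:
`(ad x)(b) = x b - (g b) x` for `x ∈ V_g`. -/
noncomputable def ad (A : YetterDrinfeld k G V) : V →ₗ[k] A.Nichols →ₗ[k] A.Nichols :=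
  A.sumComp fun g =>
    LinearMap.mul k A.Nichols ∘ₗ A.nicholsι -
      ((LinearMap.mul k A.Nichols).flip ∘ₗ A.nicholsι).compl₂ (A.nicholsAct g).toLinearMap

theorem ad_apply (A : YetterDrinfeld k G V) {g : G} {x : V} (hx : x ∈ A.comp g) (b : A.Nichols) :
    A.ad x b = A.nicholsι x * b - A.nicholsAct g b * A.nicholsι x := by
  simp [ad, A.sumComp_of_mem _ hx]

/-- The subspace `(ad V)^m(W)` of the Nichols algebra `𝓑(V ⊕ W)`: `(ad V)^0(W) = W`, and
`(ad V)^{m+1}(W)` is spanned by all `(ad v)(b)` with `v ∈ V`, `b ∈ (ad V)^m(W)`. -/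
noncomputable def adPow (A : YetterDrinfeld k G V) (B : YetterDrinfeld k G W) :
    ℕ → Submodule k (A.prod B).Nichols
  | 0 => LinearMap.range ((A.prod B).nicholsι ∘ₗ LinearMap.inr k V W)
  | m + 1 => Submodule.map₂ ((A.prod B).ad ∘ₗ LinearMap.inl k V W) ⊤ (adPow A B m)

end Nichols

end YetterDrinfeld

/-- The inner group `Inn(X) = ⟨φ_i : i ∈ X⟩`, `φ_i(j) = i ▷ j`, of a quandle `X`. -/
def Inn (X : Type*) [Quandle X] : Subgroup (Equiv.Perm X) :=
  Subgroup.closure (Set.range (Rack.act' : X → Equiv.Perm X))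

/-- A quandle is indecomposable if its inner group acts transitively. -/
def IsIndecomposable (X : Type*) [Quandle X] : Prop :=
  MulAction.IsPretransitive (Inn X) X

/-- `Y` is an orbit of the inner group. -/
def IsInnOrbit {X : Type*} [Quandle X] (Y : Set X) : Prop :=
  ∃ y : X, Y = MulAction.orbit (Inn X) y

/-! The Nichols algebra is controlled by skew derivations. On homogeneous tensors, the kernel of
T(U) → 𝓑(U) is the radical: the elements killed by every product of skew derivations followed by the
augmentation. This follows from S_{n+1} = (id ⊗ S_n)(id + c_{1,2} + ⋯ + c_{1,2} ⋯ c_{n,n+1})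
(`quantumSymm_succ`), since contracting the first factor of the right-hand parenthesis is the skew
derivation (`skewDer_toTensorAlgebra`, `toTensorAlgebra_mem_rad`). Homogeneous functionals, which
separate points, replace dual bases, so no finiteness of dimension is needed.

Take a nonzero x₁ ∈ (ad V)^m(W) of degree g₁. For n ≥ 1, derivations along W vanish on (ad V)^n(W),
so derivations along V detect nonzero elements there. Hence there are degrees f₁, …, f_m and nonzero
elements x_{i+1} = ∂_{ξ_i} x_i with ξ_i of degree f_i, ending in W_s. The degrees are g_{i+1} =
f_i⁻¹ g_i, so g₁ = f₁ ⋯ f_m s. Let C be the set of all f_i and g_i⁻¹ f_i g_i; it has at most 2m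
elements.

Let 0 ≠ v ∈ V_t with t ∉ C. Everything rests on ∂_ξ (ad v)(b) = ξ(v) b − ξ(t g t⁻¹ v) (t b) + (ad
v)(∂_{ξ∘t} b) for b of degree g (`skewDer_tensorAd`). Since (ad V)^{m+1}(W) = 0, (ad v)(x₁) = 0, and
because t ∉ C this descends to (ad v)(x_i) = 0 for all i. If t failed to commute with g_i, a
functional of degree t would give x_i = (ad v)(y). Working upward from s, assume that t commutes
with s and f_{i+1}, …, f_m but not with f_i. Then x_i = (ad v)(y), and differentiating along the
chain keeps this form until the final element of W_s becomes zero, a contradiction. So t commutes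
with s and all f_i (`DerChain.commute`), hence with all of C.

Thus the part of supp V outside C commutes with s and with the part L = C ∩ supp V. This makes L a
nonempty union of inner orbits. In the transitive case L is everything. With two orbits exchanged by
s, a point outside L would be fixed by s and so lie in both orbits (`mem_of_commute`). Hence supp V
⊆ C. If f_m commutes with s, then g_m = f_m s gives g_m⁻¹ f_m g_m = f_m, which saves one element. -/

namespace YetterDrinfeld

/-! ### Homogeneous functionals and skew derivations of the tensor algebra -/

section SkewDerivation

variable {k G U : Type*} [Field k] [Group G] [AddCommGroup U] [Module k U]

/-- A functional is homogeneous of degree `f` if it vanishes on all components of degree `≠ f`. -/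
def IsHomFunctional (A : YetterDrinfeld k G U) (f : G) (η : Module.Dual k U) : Prop :=
  ∀ h, h ≠ f → ∀ u ∈ A.comp h, η u = 0

theorem IsHomFunctional.comp_ρ {A : YetterDrinfeld k G U} {f : G} {η : Module.Dual k U}
    (hη : A.IsHomFunctional f η) (t : G) : A.IsHomFunctional (t⁻¹ * f * t) (η ∘ₗ A.ρ t) := by
  intro h hh u hu
  refine hη (t * h * t⁻¹) (fun e => hh ?_) _ (A.map_mem t h u hu)
  rw [← e]; group

theorem exists_isHomFunctional_of_separating (A : YetterDrinfeld k G U) {u : U} (hu : u ≠ 0)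
    (η₀ : U → Module.Dual k U) (hη₀ : ∀ u ≠ 0, η₀ u u ≠ 0) :
    ∃ f, ∃ η, A.IsHomFunctional f η ∧ η u ≠ 0 := by
  classical
  by_contra! hcon
  apply hu
  let e := LinearEquiv.ofBijective (DirectSum.coeLinearMap A.comp) A.isInternal
  have : e.symm u = 0 := by
    refine DFinsupp.ext fun f => ?_
    let p : U →ₗ[k] U := (A.comp f).subtype ∘ₗ DirectSum.component k G _ f ∘ₗ e.symm.toLinearMap
    by_contra hne
    have hpu : p u ≠ 0 := fun h0 => hne (Subtype.ext h0)
    -- A functional precomposed with the projection to degree f is homogeneous of degree f, so by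
    -- `hcon` it would vanish at u.
    refine hη₀ _ hpu (hcon f (η₀ (p u) ∘ₗ p) ?_)
    intro h hh v hv
    have h1 : e.symm v = DirectSum.lof k G (fun g => A.comp g) h ⟨v, hv⟩ := by
      rw [LinearEquiv.symm_apply_eq]
      exact (DirectSum.coeLinearMap_lof A.comp h ⟨v, hv⟩).symm
    have h2 : p v = 0 := by
      simp only [p, LinearMap.comp_apply, LinearEquiv.coe_coe, h1]
      rw [DirectSum.component.of, dif_neg hh, map_zero]
    rw [LinearMap.comp_apply, h2, map_zero]
  rwa [LinearEquiv.map_eq_zero_iff] at this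

/-- Homogeneous functionals separate points. -/
theorem exists_isHomFunctional (A : YetterDrinfeld k G U) {u : U} (hu : u ≠ 0) :
    ∃ f, ∃ η, A.IsHomFunctional f η ∧ η u ≠ 0 := by
  have h : ∀ u : U, ∃ η : Module.Dual k U, u ≠ 0 → η u ≠ 0 := fun u => by
    by_cases hu : u = 0
    · exact ⟨0, fun h => (h hu).elim⟩
    · by_contra! hcon
      exact hu ((Module.forall_dual_apply_eq_zero_iff k u).1 fun η => (hcon η).2)
  choose η₀ hη₀ using h
  exact A.exists_isHomFunctional_of_separating hu η₀ hη₀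

/-- Functionals that separate the points of `U` give contractions that separate the points of
`U ⊗ N`. -/
theorem exists_contraction_ne_zero {N : Type*} [AddCommGroup N] [Module k N]
    (P : Module.Dual k U → Prop) (hP : ∀ u : U, u ≠ 0 → ∃ η, P η ∧ η u ≠ 0)
    {z : U ⊗[k] N} (hz : z ≠ 0) :
    ∃ η, P η ∧ TensorProduct.lid k N (η.rTensor N z) ≠ 0 := by
  classical
  let b := Module.Basis.ofVectorSpace k N
  let e := TensorProduct.equivFinsuppOfBasisRight (M := U) b
  have he : e z ≠ 0 := by simpa using hz
  -- Expand z along a basis of N; some coefficient in U is nonzero, and a functional that is nonzero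
  -- on it suffices.
  obtain ⟨i, hi⟩ := Finsupp.ne_iff.1 he
  obtain ⟨η, hη, hne⟩ := hP _ hi
  refine ⟨η, hη, fun h0 => hne ?_⟩
  have key : ∀ z : U ⊗[k] N, b.repr (TensorProduct.lid k N (η.rTensor N z)) i = η (e z i) := by
    intro z
    induction z with
    | zero => simp
    | add x y hx hy => simp only [map_add, Finsupp.add_apply, hx, hy]
    | tmul x y => simp [e, mul_comm]
  rw [← key, h0]; simp

/-- The space on which the skew derivations of the tensor algebra are built: `x` of degree `h` sends
`(b, φ)` to `(x b, η ↦ η(x) b + x φ(h⁻¹ η))`. -/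
noncomputable def skewOpDeg (A : YetterDrinfeld k G U) (h : G) :
    U →ₗ[k] (TensorAlgebra k U × (Module.Dual k U →ₗ[k] TensorAlgebra k U)) →ₗ[k]
      (TensorAlgebra k U × (Module.Dual k U →ₗ[k] TensorAlgebra k U)) :=
  LinearMap.mk₂ k
    (fun (x : U) (p : TensorAlgebra k U × (Module.Dual k U →ₗ[k] TensorAlgebra k U)) =>
      ((TensorAlgebra.ι k x * p.1,
        { toFun := fun η => η x • p.1 + TensorAlgebra.ι k x * p.2 (η ∘ₗ A.ρ h)
          map_add' := fun η η' => by
            simp only [LinearMap.add_apply, add_smul, LinearMap.add_comp, map_add, mul_add]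
            abel
          map_smul' := fun c η => by
            simp only [LinearMap.smul_apply, smul_eq_mul, mul_smul, LinearMap.smul_comp, map_smul,
              mul_smul_comm, smul_add, RingHom.id_apply] }) :
        TensorAlgebra k U × (Module.Dual k U →ₗ[k] TensorAlgebra k U)))
    (fun x y p => Prod.ext (by simp [add_mul]) (LinearMap.ext fun η => by
      simp [add_smul, add_mul]; abel))
    (fun c x p => Prod.ext (by simp) (LinearMap.ext fun η => by
      simp [mul_smul]))
    (fun x p q => Prod.ext (by simp [mul_add]) (LinearMap.ext fun η => by
      simp [mul_add]; abel))
    (fun c x p => Prod.ext (by simp) (LinearMap.ext fun η => by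
      simp [smul_comm c]))

/-- The operators `skewOpDeg`, extended linearly to all of `U`. -/
noncomputable def skewOp (A : YetterDrinfeld k G U) :
    U →ₗ[k] Module.End k (TensorAlgebra k U × (Module.Dual k U →ₗ[k] TensorAlgebra k U)) :=
  A.sumComp
    (N := Module.End k (TensorAlgebra k U × (Module.Dual k U →ₗ[k] TensorAlgebra k U))) A.skewOpDeg

theorem skewOp_apply (A : YetterDrinfeld k G U) {h : G} {x : U} (hx : x ∈ A.comp h)
    (p : TensorAlgebra k U × (Module.Dual k U →ₗ[k] TensorAlgebra k U)) :
    (A.skewOp x p).1 = TensorAlgebra.ι k x * p.1 ∧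
    ∀ η, (A.skewOp x p).2 η = η x • p.1 + TensorAlgebra.ι k x * p.2 (η ∘ₗ A.ρ h) := by
  rw [skewOp, A.sumComp_of_mem _ hx]
  exact ⟨rfl, fun η => rfl⟩

/-- Induction on the tensor algebra by left multiplication with homogeneous vectors. -/
theorem tensor_induction (A : YetterDrinfeld k G U) {p : TensorAlgebra k U → Prop}
    (one : p 1) (mul : ∀ h, ∀ x ∈ A.comp h, ∀ b, p b → p (TensorAlgebra.ι k x * b))
    (add : ∀ a b, p a → p b → p (a + b)) (smul : ∀ (c : k) a, p a → p (c • a))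
    (a : TensorAlgebra k U) : p a := by
  have h0 : p 0 := by simpa using smul 0 1 one
  -- Stability under left multiplication is the statement that passes through products in the
  -- general induction principle.
  suffices h : ∀ b, p b → p (a * b) by simpa using h 1 one
  induction a using TensorAlgebra.induction with
  | algebraMap c => exact fun b hb => by rw [← Algebra.smul_def]; exact smul c b hb
  | ι x =>
    intro b hb
    refine A.induction_comp (p := fun x => p (TensorAlgebra.ι k x * b)) x
      (fun h x hx => mul h x hx b hb) (by simpa using h0) fun x y hx hy => ?_
    rw [map_add, add_mul]; exact add _ _ hx hy
  | mul a a' ha ha' => exact fun b hb => by rw [mul_assoc]; exact ha _ (ha' _ hb)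
  | add a a' ha ha' => exact fun b hb => by rw [add_mul]; exact add _ _ (ha _ hb) (ha' _ hb)

/-- The skew derivation `∂_η` of the tensor algebra, linear in the functional `η`, with
`∂_η (x b) = η(x) b + x ∂_{h⁻¹ η} b` for `x` of degree `h`. -/
noncomputable def skewDer (A : YetterDrinfeld k G U) (η : Module.Dual k U) :
    TensorAlgebra k U →ₗ[k] TensorAlgebra k U :=
  LinearMap.applyₗ η ∘ₗ LinearMap.snd k _ _ ∘ₗ
    LinearMap.applyₗ ((1, 0) : TensorAlgebra k U × (Module.Dual k U →ₗ[k] TensorAlgebra k U)) ∘ₗ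
    (TensorAlgebra.lift k A.skewOp).toLinearMap

theorem skewDer_apply (A : YetterDrinfeld k G U) (η : Module.Dual k U) (a : TensorAlgebra k U) :
    A.skewDer η a = (TensorAlgebra.lift k A.skewOp a (1, 0)).2 η := rfl

theorem skewDer_one (A : YetterDrinfeld k G U) (η : Module.Dual k U) : A.skewDer η 1 = 0 := by
  rw [skewDer_apply, map_one]; rfl

theorem skewDer_ι_mul (A : YetterDrinfeld k G U) (η : Module.Dual k U) {h : G} {x : U}
    (hx : x ∈ A.comp h) (b : TensorAlgebra k U) :
    A.skewDer η (TensorAlgebra.ι k x * b) =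
      η x • b + TensorAlgebra.ι k x * A.skewDer (η ∘ₗ A.ρ h) b := by
  -- The first coordinate of the action on (1, 0) reproduces the element itself. The second carries
  -- all functionals at once, because moving past x twists η by the degree of x.
  have h1 : ∀ b, (TensorAlgebra.lift k A.skewOp b (1, 0)).1 = b := fun b => by
    induction b using A.tensor_induction with
    | one => rw [map_one]; rfl
    | mul h x hx b hb =>
      rw [map_mul, TensorAlgebra.lift_ι_apply, Module.End.mul_apply, (A.skewOp_apply hx _).1, hb]
    | add a b ha hb => rw [map_add, LinearMap.add_apply, Prod.fst_add, ha, hb]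
    | smul c a ha => rw [map_smul, LinearMap.smul_apply, Prod.smul_fst, ha]
  rw [skewDer_apply, map_mul, TensorAlgebra.lift_ι_apply, Module.End.mul_apply,
    (A.skewOp_apply hx _).2, h1, skewDer_apply]

theorem skewDer_add (A : YetterDrinfeld k G U) (η η' : Module.Dual k U) (a : TensorAlgebra k U) :
    A.skewDer (η + η') a = A.skewDer η a + A.skewDer η' a := by
  simp only [skewDer_apply, map_add]

theorem skewDer_ι (A : YetterDrinfeld k G U) (η : Module.Dual k U) (x : U) :
    A.skewDer η (TensorAlgebra.ι k x) = algebraMap k _ (η x) := by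
  refine A.induction_comp (p := fun x => A.skewDer η (TensorAlgebra.ι k x) = algebraMap k _ (η x))
    x ?_ (by simp) (fun x y hx hy => by simp only [map_add, hx, hy])
  intro h x hx
  have := A.skewDer_ι_mul η hx 1
  rwa [skewDer_one, mul_one, mul_zero, add_zero, ← Algebra.algebraMap_eq_smul_one] at this

theorem tensorAct_ι (A : YetterDrinfeld k G U) (t : G) (x : U) :
    A.tensorAct t (TensorAlgebra.ι k x) = TensorAlgebra.ι k (A.ρ t x) := by
  simp [tensorAct]

theorem tensorAct_tensorAct (A : YetterDrinfeld k G U) (g h : G) (a : TensorAlgebra k U) :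
    A.tensorAct g (A.tensorAct h a) = A.tensorAct (g * h) a := by
  rw [← AlgHom.comp_apply]
  congr 1
  refine TensorAlgebra.hom_ext (LinearMap.ext fun x => ?_)
  simp [tensorAct_ι, map_mul]

theorem skewDer_tensorAct (A : YetterDrinfeld k G U) (t : G) (η : Module.Dual k U)
    (b : TensorAlgebra k U) :
    A.skewDer η (A.tensorAct t b) = A.tensorAct t (A.skewDer (η ∘ₗ A.ρ t) b) := by
  induction b using A.tensor_induction generalizing η with
  | one => simp [skewDer_one]
  | mul h x hx b hb =>
    rw [map_mul, tensorAct_ι, A.skewDer_ι_mul _ (A.map_mem t h x hx), A.skewDer_ι_mul _ hx, hb,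
      map_add, map_mul (A.tensorAct t), map_smul, tensorAct_ι]
    have : (η ∘ₗ A.ρ (t * h * t⁻¹)) ∘ₗ A.ρ t = (η ∘ₗ A.ρ t) ∘ₗ A.ρ h := by
      refine LinearMap.ext fun u => ?_
      simp only [LinearMap.comp_apply, ← Module.End.mul_apply, ← map_mul]
      simp
    rw [this]; rfl
  | add a b ha hb => simp only [map_add, ha, hb]
  | smul c a ha => simp only [map_smul, ha]

/-- The elements of the tensor algebra that are homogeneous of degree `g ∈ G`. -/
inductive IsHomTensor (A : YetterDrinfeld k G U) : G → TensorAlgebra k U → Prop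
  | one : IsHomTensor A 1 1
  | mul {h g : G} {x : U} {b : TensorAlgebra k U} (hx : x ∈ A.comp h) (hb : IsHomTensor A g b) :
      IsHomTensor A (h * g) (TensorAlgebra.ι k x * b)
  | zero (g : G) : IsHomTensor A g 0
  | add {g : G} {a b : TensorAlgebra k U} (ha : IsHomTensor A g a) (hb : IsHomTensor A g b) :
      IsHomTensor A g (a + b)
  | smul {g : G} (c : k) {a : TensorAlgebra k U} (ha : IsHomTensor A g a) :
      IsHomTensor A g (c • a)

theorem IsHomTensor.ι {A : YetterDrinfeld k G U} {h : G} {x : U} (hx : x ∈ A.comp h) :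
    A.IsHomTensor h (TensorAlgebra.ι k x) := by
  simpa using IsHomTensor.mul hx .one

theorem IsHomTensor.mul' {A : YetterDrinfeld k G U} {g h : G} {a b : TensorAlgebra k U}
    (ha : A.IsHomTensor g a) (hb : A.IsHomTensor h b) : A.IsHomTensor (g * h) (a * b) := by
  induction ha with
  | one => simpa using hb
  | mul hx _ ih => rw [mul_assoc, mul_assoc]; exact .mul hx ih
  | zero g => rw [zero_mul]; exact .zero _
  | add _ _ ih ih' => rw [add_mul]; exact .add ih ih'
  | smul c _ ih => rw [smul_mul_assoc]; exact .smul c ih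

theorem IsHomTensor.neg {A : YetterDrinfeld k G U} {g : G} {a : TensorAlgebra k U}
    (ha : A.IsHomTensor g a) : A.IsHomTensor g (-a) := by
  simpa using ha.smul (-1)

theorem IsHomTensor.act {A : YetterDrinfeld k G U} {g : G} {a : TensorAlgebra k U}
    (ha : A.IsHomTensor g a) (t : G) : A.IsHomTensor (t * g * t⁻¹) (A.tensorAct t a) := by
  induction ha with
  | one => simpa using .one
  | @mul h g x b hx _ ih =>
    rw [map_mul, tensorAct_ι, show t * (h * g) * t⁻¹ = (t * h * t⁻¹) * (t * g * t⁻¹) by group]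
    exact .mul (A.map_mem t h x hx) ih
  | zero g => rw [map_zero]; exact .zero _
  | add _ _ ih ih' => rw [map_add]; exact .add ih ih'
  | smul c _ ih => rw [map_smul]; exact .smul c ih

/-- The skew Leibniz rule. -/
theorem IsHomTensor.skewDer_mul {A : YetterDrinfeld k G U} {g : G} {a : TensorAlgebra k U}
    (ha : A.IsHomTensor g a) (η : Module.Dual k U) (c : TensorAlgebra k U) :
    A.skewDer η (a * c) = A.skewDer η a * c + a * A.skewDer (η ∘ₗ A.ρ g) c := by
  induction ha generalizing η with
  | one => simp [skewDer_one, Module.End.one_eq_id]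
  | @mul h g x b hx _ ih =>
    rw [mul_assoc, A.skewDer_ι_mul _ hx, A.skewDer_ι_mul _ hx, ih]
    have : (η ∘ₗ A.ρ h) ∘ₗ A.ρ g = η ∘ₗ A.ρ (h * g) := by
      rw [map_mul]; rfl
    rw [this]
    simp only [mul_add, add_mul, smul_mul_assoc, mul_assoc, add_assoc]
  | zero g => simp
  | add _ _ ih ih' => simp only [add_mul, map_add, ih, ih']; abel
  | smul c _ ih => simp only [smul_mul_assoc, map_smul, ih, smul_add]

theorem IsHomTensor.skewDer {A : YetterDrinfeld k G U} {g f : G} {a : TensorAlgebra k U}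
    (ha : A.IsHomTensor g a) {η : Module.Dual k U} (hη : A.IsHomFunctional f η) :
    A.IsHomTensor (f⁻¹ * g) (A.skewDer η a) := by
  induction ha generalizing η f with
  | one => rw [skewDer_one]; exact .zero _
  | @mul h g x b hx hb ih =>
    rw [A.skewDer_ι_mul _ hx]
    refine .add ?_ ?_
    · by_cases hf : h = f
      · subst hf; rw [inv_mul_cancel_left]; exact hb.smul _
      · rw [hη h hf x hx, zero_smul]; exact .zero _
    · have := IsHomTensor.mul hx (ih (hη.comp_ρ h))
      rwa [show h * ((h⁻¹ * f * h)⁻¹ * g) = f⁻¹ * (h * g) by group] at this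
  | zero g => rw [map_zero]; exact .zero _
  | add _ _ ih ih' => rw [map_add]; exact .add (ih hη) (ih' hη)
  | smul c _ ih => rw [map_smul]; exact .smul c (ih hη)

theorem IsHomTensor.algebraMapInv_eq_zero {A : YetterDrinfeld k G U} {g : G}
    {a : TensorAlgebra k U} (ha : A.IsHomTensor g a) (hg : g ≠ 1) :
    TensorAlgebra.algebraMapInv a = 0 := by
  induction ha with
  | one => exact (hg rfl).elim
  | mul hx _ _ => simp [TensorAlgebra.algebraMapInv]
  | zero g => simp
  | add _ _ ih ih' => rw [map_add, ih hg, ih' hg, add_zero]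
  | smul c _ ih => rw [map_smul, ih hg, smul_zero]

/-- Supplies homogeneous pieces for the Leibniz rule, which needs a left factor of known degree.
Uniqueness of the decomposition is not required. -/
theorem exists_sum_isHomTensor (A : YetterDrinfeld k G U) (a : TensorAlgebra k U) :
    ∃ (s : Finset G) (f : G → TensorAlgebra k U), (∀ g, A.IsHomTensor g (f g)) ∧
      a = ∑ g ∈ s, f g := by
  classical
  let S : G → Submodule k (TensorAlgebra k U) := fun g =>
    { carrier := {a | A.IsHomTensor g a}
      add_mem' := .add
      zero_mem' := .zero g
      smul_mem' := fun c _ h => .smul c h }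
  have h : a ∈ iSup S := by
    induction a using A.tensor_induction with
    | one => exact Submodule.mem_iSup_of_mem 1 IsHomTensor.one
    | mul h x hx b hb =>
      refine Submodule.iSup_induction S (motive := fun b => TensorAlgebra.ι k x * b ∈ iSup S) hb
        (fun g b hb => Submodule.mem_iSup_of_mem (h * g) (IsHomTensor.mul hx hb))
        (by simp) fun a b ha hb => ?_
      rw [mul_add]; exact Submodule.add_mem _ ha hb
    | add a b ha hb => exact Submodule.add_mem _ ha hb
    | smul c a ha => exact Submodule.smul_mem _ _ ha
  obtain ⟨f, hf⟩ := (Submodule.mem_iSup_iff_exists_finsupp S a).1 h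
  exact ⟨f.support, f, hf.1, hf.2.symm⟩

end SkewDerivation

/-! ### The radical of the skew derivations and the kernels of the quantum symmetrizers -/

section Radical

variable {k G U : Type*} [Field k] [Group G] [AddCommGroup U] [Module k U]

theorem idTensor_cons {n : ℕ} (f : (⨂[k]^n U) →ₗ[k] ⨂[k]^n U) (z : U ⊗[k] (⨂[k]^n U)) :
    idTensor f (cons k U n z) = cons k U n (f.lTensor U z) := by
  simp [idTensor]

theorem idTensor_comp {n : ℕ} (f g : (⨂[k]^n U) →ₗ[k] ⨂[k]^n U) :
    idTensor (f ∘ₗ g) = idTensor f ∘ₗ idTensor g := by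
  refine LinearMap.ext fun t => ?_
  obtain ⟨z, rfl⟩ := (cons k U n).surjective t
  rw [LinearMap.comp_apply, idTensor_cons, idTensor_cons, idTensor_cons, LinearMap.lTensor_comp]
  rfl

/-- Induction on `V^{⊗ (n+1)}` over `x ⊗ t` with `x` homogeneous. -/
theorem tensorPower_succ_induction (A : YetterDrinfeld k G U) {n : ℕ}
    {p : (⨂[k]^(n + 1) U) → Prop}
    (cons : ∀ h, ∀ x ∈ A.comp h, ∀ t : ⨂[k]^n U, p (cons k U n (x ⊗ₜ t)))
    (add : ∀ s t, p s → p t → p (s + t)) (t : ⨂[k]^(n + 1) U) : p t := by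
  obtain ⟨z, rfl⟩ := (YetterDrinfeld.cons k U n).surjective t
  have h0 : p 0 := by simpa using cons 1 0 (Submodule.zero_mem _) 0
  induction z with
  | zero => rwa [map_zero]
  | add x y hx hy => rw [map_add]; exact add _ _ hx hy
  | tmul x t =>
    refine A.induction_comp (p := fun x => p (YetterDrinfeld.cons k U n (x ⊗ₜ t))) x
      (fun h x hx => cons h x hx t) (by simpa using h0) fun x y hx hy => ?_
    rw [TensorProduct.add_tmul, map_add]; exact add _ _ hx hy

theorem braidFirst_cons (A : YetterDrinfeld k G U) (n : ℕ) {h : G} {x : U} (hx : x ∈ A.comp h)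
    (y : U) (t : ⨂[k]^n U) :
    A.braidFirst n (cons k U (n + 1) (x ⊗ₜ cons k U n (y ⊗ₜ t))) =
      cons k U (n + 1) (A.ρ h y ⊗ₜ cons k U n (x ⊗ₜ t)) := by
  simp [braidFirst, A.braiding_tmul hx]

theorem braidFirst_idTensor (A : YetterDrinfeld k G U) {n : ℕ}
    (f : (⨂[k]^n U) →ₗ[k] ⨂[k]^n U) :
    A.braidFirst n ∘ₗ idTensor (idTensor f) = idTensor (idTensor f) ∘ₗ A.braidFirst n := by
  refine LinearMap.ext fun t => ?_
  induction t using A.tensorPower_succ_induction with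
  | add s t hs ht => rw [map_add, map_add, hs, ht]
  | cons h x hx t =>
    induction t using A.tensorPower_succ_induction with
    | add s t hs ht => rw [TensorProduct.tmul_add, map_add, map_add, map_add, hs, ht]
    | cons g y hy t =>
      simp only [LinearMap.comp_apply, idTensor_cons, LinearMap.lTensor_tmul,
        A.braidFirst_cons _ hx]

/-- The endomorphism `id + c_{1,2} + c_{1,2} c_{2,3} + ⋯ + c_{1,2} c_{2,3} ⋯ c_{n,n+1}` of
`V^{⊗ (n+1)}`. -/
noncomputable def coshuffle (A : YetterDrinfeld k G U) :
    (n : ℕ) → (⨂[k]^(n + 1) U) →ₗ[k] ⨂[k]^(n + 1) U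
  | 0 => LinearMap.id
  | n + 1 => LinearMap.id + A.braidFirst n ∘ₗ idTensor (coshuffle A n)

/-- The inductive step that turns the factorization with `shuffle` on the left into one with
`coshuffle` on the right. It works because c_{1,2} commutes with id ⊗ id ⊗ S. -/
theorem shuffle_step (A : YetterDrinfeld k G U) {n : ℕ} {S : (⨂[k]^n U) →ₗ[k] ⨂[k]^n U}
    {f D S' : (⨂[k]^(n + 1) U) →ₗ[k] ⨂[k]^(n + 1) U} (h₁ : S' = f ∘ₗ idTensor S)
    (h₂ : S' = idTensor S ∘ₗ D) :
    (LinearMap.id + idTensor f ∘ₗ A.braidFirst n) ∘ₗ idTensor S' =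
      idTensor S' ∘ₗ (LinearMap.id + A.braidFirst n ∘ₗ idTensor D) := by
  refine LinearMap.ext fun t => ?_
  have e₁ : ∀ t, idTensor S' t = idTensor f (idTensor (idTensor S) t) := fun t => by
    rw [h₁, idTensor_comp]; rfl
  have e₂ : ∀ t, idTensor S' t = idTensor (idTensor S) (idTensor D t) := fun t => by
    rw [h₂, idTensor_comp]; rfl
  have e₃ : ∀ t, A.braidFirst n (idTensor (idTensor S) t) =
      idTensor (idTensor S) (A.braidFirst n t) := LinearMap.congr_fun (A.braidFirst_idTensor S)
  simp only [LinearMap.comp_apply, LinearMap.add_apply, LinearMap.id_apply, map_add]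
  rw [e₁ (A.braidFirst n _), ← e₃, ← e₂]

/-- The factorization `S_{n+1} = (id ⊗ S_n) (id + c_{1,2} + ⋯ + c_{1,2} ⋯ c_{n,n+1})`. -/
theorem quantumSymm_succ (A : YetterDrinfeld k G U) :
    ∀ n, A.quantumSymm (n + 1) = idTensor (A.quantumSymm n) ∘ₗ A.coshuffle n
  | 0 => rfl
  | n + 1 => A.shuffle_step rfl (quantumSymm_succ A n)

/-- Contraction of the first tensor factor. -/
noncomputable def contract (η : Module.Dual k U) (n : ℕ) : (⨂[k]^(n + 1) U) →ₗ[k] ⨂[k]^n U :=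
  (TensorProduct.lid k _).toLinearMap ∘ₗ η.rTensor _ ∘ₗ (cons k U n).symm.toLinearMap

theorem contract_cons (η : Module.Dual k U) (n : ℕ) (x : U) (t : ⨂[k]^n U) :
    contract η n (cons k U n (x ⊗ₜ t)) = η x • t := by
  simp [contract]

theorem contract_idTensor (η : Module.Dual k U) {n : ℕ} (f : (⨂[k]^n U) →ₗ[k] ⨂[k]^n U)
    (t : ⨂[k]^(n + 1) U) : contract η n (idTensor f t) = f (contract η n t) := by
  obtain ⟨z, rfl⟩ := (cons k U n).surjective t
  induction z with
  | zero => simp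
  | add x y hx hy => simp only [map_add, hx, hy]
  | tmul x t => simp [idTensor_cons, contract_cons]

theorem exists_contract_ne_zero (A : YetterDrinfeld k G U) {n : ℕ} {t : ⨂[k]^(n + 1) U}
    (ht : t ≠ 0) : ∃ f, ∃ η, A.IsHomFunctional f η ∧ contract η n t ≠ 0 := by
  obtain ⟨η, ⟨f, hη⟩, h⟩ := exists_contraction_ne_zero (N := ⨂[k]^n U)
    (fun η => ∃ f, A.IsHomFunctional f η)
    (fun u hu => by
      obtain ⟨f, η, h1, h2⟩ := A.exists_isHomFunctional hu
      exact ⟨η, ⟨f, h1⟩, h2⟩)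
    (z := (cons k U n).symm t) (by simpa using ht)
  exact ⟨f, η, hη, h⟩

theorem toTensorAlgebra_cons (n : ℕ) (x : U) (t : ⨂[k]^n U) :
    TensorPower.toTensorAlgebra (cons k U n (x ⊗ₜ t)) =
      TensorAlgebra.ι k x * TensorPower.toTensorAlgebra t := by
  have key : TensorPower.toTensorAlgebra ∘ₗ (cons k U n).toLinearMap ∘ₗ TensorProduct.mk k _ _ x =
      LinearMap.mulLeft k (TensorAlgebra.ι k x) ∘ₗ TensorPower.toTensorAlgebra := by
    refine PiTensorProduct.ext (MultilinearMap.ext fun v => ?_)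
    simp [cons_tmul_tprod, TensorAlgebra.tprod_apply]
  exact LinearMap.congr_fun key t

theorem toTensorAlgebra_zero_eq (t : ⨂[k]^0 U) :
    TensorPower.toTensorAlgebra t =
      algebraMap k (TensorAlgebra k U) (PiTensorProduct.isEmptyEquiv (R := k) (Fin 0) t) := by
  have key : (TensorPower.toTensorAlgebra : (⨂[k]^0 U) →ₗ[k] TensorAlgebra k U) =
      Algebra.linearMap k _ ∘ₗ (PiTensorProduct.isEmptyEquiv (R := k) (Fin 0)).toLinearMap := by
    refine PiTensorProduct.ext (MultilinearMap.ext fun v => ?_)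
    simp [TensorAlgebra.tprod_apply]
  exact LinearMap.congr_fun key t

/-- Letting η act past the first factor x amounts to braiding x with the next factor and then
contracting, so the recursion of `skewDer` is that of `coshuffle`. -/
theorem skewDer_toTensorAlgebra (A : YetterDrinfeld k G U) (η : Module.Dual k U) :
    ∀ (n : ℕ) (t : ⨂[k]^(n + 1) U),
      A.skewDer η (TensorPower.toTensorAlgebra t) =
        TensorPower.toTensorAlgebra (contract η n (A.coshuffle n t)) := by
  intro n
  induction n generalizing η with
  | zero =>
    intro t
    induction t using A.tensorPower_succ_induction with
    | add s t hs ht => simp only [map_add, hs, ht]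
    | cons h x hx t =>
      rw [toTensorAlgebra_cons, A.skewDer_ι_mul _ hx, toTensorAlgebra_zero_eq,
        Algebra.algebraMap_eq_smul_one, map_smul, skewDer_one, smul_zero, mul_zero, add_zero,
        coshuffle, LinearMap.id_apply, contract_cons, map_smul, toTensorAlgebra_zero_eq,
        Algebra.algebraMap_eq_smul_one]
  | succ n ih =>
    intro t
    induction t using A.tensorPower_succ_induction with
    | add s t hs ht => simp only [map_add, hs, ht]
    | cons h x hx t =>
      -- After c_{1,2} the first slot holds h y, so contracting with η means contracting y with η ∘
      -- h and keeping x on the left.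
      have key : ∀ u : ⨂[k]^(n + 1) U, TensorPower.toTensorAlgebra
          (contract η (n + 1) (A.braidFirst n (cons k U (n + 1) (x ⊗ₜ u)))) =
          TensorAlgebra.ι k x *
            TensorPower.toTensorAlgebra (contract (η ∘ₗ A.ρ h) n u) := by
        intro u
        induction u using A.tensorPower_succ_induction with
        | add s t hs ht => simp only [TensorProduct.tmul_add, map_add, hs, ht, mul_add]
        | cons g y hy u =>
          rw [A.braidFirst_cons n hx, contract_cons, contract_cons, map_smul, map_smul,
            toTensorAlgebra_cons, mul_smul_comm]
          rfl
      rw [toTensorAlgebra_cons, A.skewDer_ι_mul _ hx, ih, coshuffle, LinearMap.add_apply,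
        LinearMap.id_apply, LinearMap.comp_apply, map_add, map_add, contract_cons, map_smul,
        idTensor_cons, LinearMap.lTensor_tmul, key]

/-- The elements killed by all products of `n` homogeneous skew derivations, followed by the
augmentation. -/
noncomputable def radLevel (A : YetterDrinfeld k G U) :
    ℕ → Submodule k (TensorAlgebra k U)
  | 0 => LinearMap.ker (TensorAlgebra.algebraMapInv (R := k) (M := U)).toLinearMap
  | n + 1 => ⨅ (f : G) (η : Module.Dual k U) (_ : A.IsHomFunctional f η),
      (radLevel A n).comap (A.skewDer η)

/-- The elements of the tensor algebra killed by all products of homogeneous skew derivations,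
followed by the augmentation. -/
noncomputable def rad (A : YetterDrinfeld k G U) : Submodule k (TensorAlgebra k U) :=
  ⨅ n, A.radLevel n

theorem mem_radLevel_zero (A : YetterDrinfeld k G U) {a : TensorAlgebra k U} :
    a ∈ A.radLevel 0 ↔ TensorAlgebra.algebraMapInv a = 0 := Iff.rfl

theorem mem_radLevel_succ (A : YetterDrinfeld k G U) {n : ℕ} {a : TensorAlgebra k U} :
    a ∈ A.radLevel (n + 1) ↔
      ∀ f η, A.IsHomFunctional f η → A.skewDer η a ∈ A.radLevel n := by
  simp [radLevel, Submodule.mem_iInf]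

theorem mem_rad (A : YetterDrinfeld k G U) {a : TensorAlgebra k U} :
    a ∈ A.rad ↔ ∀ n, a ∈ A.radLevel n := by
  simp [rad, Submodule.mem_iInf]

theorem skewDer_mem_rad (A : YetterDrinfeld k G U) {f : G} {η : Module.Dual k U}
    (hη : A.IsHomFunctional f η) {a : TensorAlgebra k U} (ha : a ∈ A.rad) :
    A.skewDer η a ∈ A.rad :=
  A.mem_rad.2 fun n => A.mem_radLevel_succ.1 (A.mem_rad.1 ha (n + 1)) f η hη

theorem mem_rad_of_skewDer (A : YetterDrinfeld k G U) {a : TensorAlgebra k U}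
    (h0 : TensorAlgebra.algebraMapInv a = 0)
    (h : ∀ f η, A.IsHomFunctional f η → A.skewDer η a ∈ A.rad) : a ∈ A.rad :=
  A.mem_rad.2 fun n => match n with
    | 0 => h0
    | n + 1 => A.mem_radLevel_succ.2 fun f η hη => A.mem_rad.1 (h f η hη) n

theorem mul_mem_rad_left (A : YetterDrinfeld k G U) (c : TensorAlgebra k U)
    {a : TensorAlgebra k U} (ha : a ∈ A.rad) : c * a ∈ A.rad := by
  induction c using A.tensor_induction with
  | one => rwa [one_mul]
  | add b c hb hc => rw [add_mul]; exact Submodule.add_mem _ hb hc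
  | smul r c hc => rw [smul_mul_assoc]; exact Submodule.smul_mem _ _ hc
  | mul h x hx b hb =>
    rw [mul_assoc]
    generalize b * a = a' at hb
    refine A.mem_rad.2 fun n => ?_
    induction n generalizing a' h x with
    | zero => rw [mem_radLevel_zero]; simp [TensorAlgebra.algebraMapInv]
    | succ n ih =>
      refine A.mem_radLevel_succ.2 fun f η hη => ?_
      rw [A.skewDer_ι_mul _ hx]
      exact Submodule.add_mem _ (Submodule.smul_mem _ _ (A.mem_rad.1 hb n))
        (ih h x hx _ (A.skewDer_mem_rad (hη.comp_ρ h) hb))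

/-- The augmentation sees only degree 1, and the degrees are distinct, so at most one summand
survives it. A derivation of degree f moves all degrees by left multiplication by f⁻¹, which keeps
them distinct; this is why φ is allowed in the induction. -/
theorem mem_radLevel_of_sum_mem (A : YetterDrinfeld k G U) {n : ℕ} (s : Finset G) {φ : G → G}
    (hφ : Function.Injective φ) {a : G → TensorAlgebra k U} (ha : ∀ g, A.IsHomTensor (φ g) (a g))
    (hs : ∑ g ∈ s, a g ∈ A.radLevel n) : ∀ g ∈ s, a g ∈ A.radLevel n := by
  induction n generalizing φ a with
  | zero =>
    intro g hg
    rw [mem_radLevel_zero] at hs ⊢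
    by_cases h1 : φ g = 1
    · rwa [map_sum, Finset.sum_eq_single_of_mem g hg fun g' _ hne =>
        (ha g').algebraMapInv_eq_zero fun h => hne (hφ (h.trans h1.symm))] at hs
    · exact (ha g).algebraMapInv_eq_zero h1
  | succ n ih =>
    intro g hg
    refine A.mem_radLevel_succ.2 fun f η hη => ?_
    refine ih (φ := fun g => f⁻¹ * φ g) (fun x y h => hφ (mul_left_cancel h))
      (a := fun g => A.skewDer η (a g)) (fun g => (ha g).skewDer hη) ?_ g hg
    rw [← map_sum]
    exact A.mem_radLevel_succ.1 hs f η hη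

/-- The Leibniz rule twists the functional by the degree of the left factor, so the element of the
radical must first be split into homogeneous components. -/
theorem mul_mem_rad_right (A : YetterDrinfeld k G U) {a : TensorAlgebra k U} (ha : a ∈ A.rad)
    (c : TensorAlgebra k U) : a * c ∈ A.rad := by
  obtain ⟨s, f, hf, rfl⟩ := A.exists_sum_isHomTensor a
  rw [Finset.sum_mul]
  refine Submodule.sum_mem _ fun g hg => ?_
  have h1 : f g ∈ A.rad := A.mem_rad.2 fun n =>
    A.mem_radLevel_of_sum_mem s Function.injective_id hf (A.mem_rad.1 ha n) g hg
  refine A.mem_rad.2 fun n => ?_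
  have h2 := hf g
  generalize f g = b at h1 h2
  clear hf ha hg
  induction n generalizing b c g with
  | zero =>
    rw [mem_radLevel_zero, map_mul, A.mem_radLevel_zero.1 (A.mem_rad.1 h1 0), zero_mul]
  | succ n ih =>
    refine A.mem_radLevel_succ.2 fun e η hη => ?_
    rw [h2.skewDer_mul]
    exact Submodule.add_mem _ (ih _ _ _ (A.skewDer_mem_rad hη h1) (h2.skewDer hη))
      (ih _ _ _ h1 h2)

/-- By the right factorization, contracting S_{n+1} t with η gives S_n applied to the tensor of ∂_η
t. Since contractions with homogeneous functionals separate tensors, induction on n applies. -/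
theorem toTensorAlgebra_mem_rad (A : YetterDrinfeld k G U) :
    ∀ (n : ℕ) (t : ⨂[k]^n U),
      TensorPower.toTensorAlgebra t ∈ A.rad ↔ A.quantumSymm n t = 0
  | 0, t => by
    rw [quantumSymm, LinearMap.id_apply, toTensorAlgebra_zero_eq]
    constructor
    · intro h
      have h0 := A.mem_radLevel_zero.1 (A.mem_rad.1 h 0)
      rw [TensorAlgebra.algebraMap_leftInverse] at h0
      simpa using h0
    · rintro rfl
      simp
  | n + 1, t => by
    have h0 : TensorAlgebra.algebraMapInv (TensorPower.toTensorAlgebra t) = 0 := by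
      induction t using A.tensorPower_succ_induction with
      | add s t hs ht => rw [map_add, map_add, hs, ht, add_zero]
      | cons h x hx t => rw [toTensorAlgebra_cons]; simp [TensorAlgebra.algebraMapInv]
    have h1 : ∀ η : Module.Dual k U, A.skewDer η (TensorPower.toTensorAlgebra t) ∈ A.rad ↔
        contract η n (A.quantumSymm (n + 1) t) = 0 := fun η => by
      rw [skewDer_toTensorAlgebra, toTensorAlgebra_mem_rad A n, quantumSymm_succ,
        LinearMap.comp_apply, contract_idTensor]
    constructor
    · intro h
      by_contra hne
      obtain ⟨f, η, hη, hc⟩ := A.exists_contract_ne_zero hne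
      exact hc ((h1 η).1 (A.skewDer_mem_rad hη h))
    · intro h
      refine A.mem_rad_of_skewDer h0 fun f η _ => (h1 η).2 ?_
      rw [h, map_zero]

/-- On homogeneous tensors, the radical is the kernel of the map to the Nichols algebra. -/
theorem nicholsMk_toTensorAlgebra_eq_zero_iff (A : YetterDrinfeld k G U) {n : ℕ}
    (t : ⨂[k]^n U) :
    A.nicholsMk (TensorPower.toTensorAlgebra t) = 0 ↔
      TensorPower.toTensorAlgebra t ∈ A.rad := by
  constructor
  · intro h
    -- The radical is an ideal containing all defining relations, so T(U) → T(U)/rad factors through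
    -- the Nichols algebra.
    let I : TwoSidedIdeal (TensorAlgebra k U) := TwoSidedIdeal.mk' A.rad (Submodule.zero_mem _)
      (fun hx hy => Submodule.add_mem _ hx hy) (fun hx => Submodule.neg_mem _ hx)
      (fun hy => A.mul_mem_rad_left _ hy) (fun hx => A.mul_mem_rad_right hx _)
    have hI : ∀ a, I.ringCon.mkₐ k a = 0 ↔ a ∈ A.rad := fun a => by
      have h1 : I.ringCon.mkₐ k a = 0 ↔ I.ringCon a 0 := by
        rw [← map_zero (I.ringCon.mkₐ k)]
        exact I.ringCon.eq
      rw [h1, ← TwoSidedIdeal.mem_iff]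
      exact TwoSidedIdeal.mem_mk' ..
    have h2 := A.nicholsLift_mk (I.ringCon.mkₐ k)
      (fun n t ht => (hI _).2 ((A.toTensorAlgebra_mem_rad n t).2 ht))
      (TensorPower.toTensorAlgebra t)
    rw [h, map_zero] at h2
    exact (hI _).1 h2.symm
  · exact fun h => A.nicholsMk_eq_zero _ ((A.toTensorAlgebra_mem_rad n t).1 h)

end Radical

/-! ### The adjoint action lifted to the tensor algebra -/

section TensorAd

variable {k G U : Type*} [Field k] [Group G] [AddCommGroup U] [Module k U]

/-- The braided adjoint action `b ↦ x b - (t b) x` on the tensor algebra, for `x` of degree `t`. -/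
noncomputable def tensorAd (A : YetterDrinfeld k G U) (t : G) (x : U) :
    TensorAlgebra k U →ₗ[k] TensorAlgebra k U :=
  LinearMap.mulLeft k (TensorAlgebra.ι k x) -
    LinearMap.mulRight k (TensorAlgebra.ι k x) ∘ₗ (A.tensorAct t).toLinearMap

theorem tensorAd_apply (A : YetterDrinfeld k G U) (t : G) (x : U) (b : TensorAlgebra k U) :
    A.tensorAd t x b = TensorAlgebra.ι k x * b - A.tensorAct t b * TensorAlgebra.ι k x := rfl

theorem nicholsMk_tensorAd (A : YetterDrinfeld k G U) {t : G} {x : U} (hx : x ∈ A.comp t)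
    (b : TensorAlgebra k U) : A.nicholsMk (A.tensorAd t x b) = A.ad x (A.nicholsMk b) := by
  rw [A.ad_apply hx, tensorAd_apply, map_sub, map_mul, map_mul]
  simp [nicholsAct, nicholsLift_mk, nicholsι]

theorem tensorAd_algebraMap (A : YetterDrinfeld k G U) (t : G) (x : U) (c : k) :
    A.tensorAd t x (algebraMap k _ c) = 0 := by
  rw [tensorAd_apply, AlgHom.commutes, Algebra.commutes, sub_self]

theorem tensorAct_tensorAd (A : YetterDrinfeld k G U) (h t : G) (x : U)
    (b : TensorAlgebra k U) :
    A.tensorAct h (A.tensorAd t x b) =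
      A.tensorAd (h * t * h⁻¹) (A.ρ h x) (A.tensorAct h b) := by
  simp only [tensorAd_apply, map_sub, map_mul (A.tensorAct h), tensorAct_ι, tensorAct_tensorAct]
  rw [inv_mul_cancel_right]

theorem IsHomTensor.tensorAd {A : YetterDrinfeld k G U} {t g : G} {x : U} (hx : x ∈ A.comp t)
    {b : TensorAlgebra k U} (hb : A.IsHomTensor g b) :
    A.IsHomTensor (t * g) (A.tensorAd t x b) := by
  rw [tensorAd_apply, sub_eq_add_neg]
  refine .add (.mul hx hb) (.neg ?_)
  simpa using (hb.act t).mul' (.ι hx)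

/-- The Leibniz rule on x b and on (t b) x gives two boundary terms where η meets x. Since ∂_η (t b)
= t ∂_{η∘t} b, the other two terms recombine into an adjoint action. -/
theorem skewDer_tensorAd (A : YetterDrinfeld k G U) (η : Module.Dual k U) {t g : G} {x : U}
    (hx : x ∈ A.comp t) {b : TensorAlgebra k U} (hb : A.IsHomTensor g b) :
    A.skewDer η (A.tensorAd t x b) =
      η x • b - η (A.ρ (t * g * t⁻¹) x) • A.tensorAct t b +
        A.tensorAd t x (A.skewDer (η ∘ₗ A.ρ t) b) := by
  rw [tensorAd_apply, map_sub, A.skewDer_ι_mul _ hx, (hb.act t).skewDer_mul, skewDer_ι,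
    skewDer_tensorAct, tensorAd_apply, ← Algebra.commutes, ← Algebra.smul_def,
    LinearMap.comp_apply]
  abel

end TensorAd

/-! ### Homogeneous lifts of (ad V)^n(W) and their derivatives -/

section AdWord

variable {k G V W : Type*} [Field k] [Group G] [AddCommGroup V] [Module k V]
  [AddCommGroup W] [Module k W]

/-- The elements of degree `g ∈ G` of the lift of `(ad V)^n(W)` to the tensor algebra. -/
inductive AdWord (A : YetterDrinfeld k G V) (B : YetterDrinfeld k G W) :
    ℕ → G → TensorAlgebra k (V × W) → Prop
  | of {s : G} {w : W} (hw : w ∈ B.comp s) : AdWord A B 0 s (TensorAlgebra.ι k (0, w))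
  | ad {n : ℕ} {t g : G} {v : V} {b : TensorAlgebra k (V × W)} (hv : v ∈ A.comp t)
      (hb : AdWord A B n g b) : AdWord A B (n + 1) (t * g) ((A.prod B).tensorAd t (v, 0) b)
  | zero (n : ℕ) (g : G) : AdWord A B n g 0
  | add {n : ℕ} {g : G} {a b : TensorAlgebra k (V × W)} (ha : AdWord A B n g a)
      (hb : AdWord A B n g b) : AdWord A B n g (a + b)
  | smul {n : ℕ} {g : G} (c : k) {a : TensorAlgebra k (V × W)} (ha : AdWord A B n g a) :
      AdWord A B n g (c • a)

variable {A : YetterDrinfeld k G V} {B : YetterDrinfeld k G W}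

theorem inl_mem_comp {t : G} {v : V} (hv : v ∈ A.comp t) : (v, 0) ∈ (A.prod B).comp t :=
  ⟨hv, Submodule.zero_mem _⟩

theorem inr_mem_comp {t : G} {w : W} (hw : w ∈ B.comp t) : (0, w) ∈ (A.prod B).comp t :=
  ⟨Submodule.zero_mem _, hw⟩

theorem AdWord.isHomTensor {n : ℕ} {g : G} {b : TensorAlgebra k (V × W)}
    (hb : AdWord A B n g b) : (A.prod B).IsHomTensor g b := by
  induction hb with
  | of hw => exact .ι (inr_mem_comp hw)
  | ad hv _ ih => exact .tensorAd (inl_mem_comp hv) ih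
  | zero n g => exact .zero g
  | add _ _ ih ih' => exact .add ih ih'
  | smul c _ ih => exact .smul c ih

theorem AdWord.neg {n : ℕ} {g : G} {b : TensorAlgebra k (V × W)}
    (hb : AdWord A B n g b) : AdWord A B n g (-b) := by
  simpa using hb.smul (-1)

theorem AdWord.sub {n : ℕ} {g : G} {a b : TensorAlgebra k (V × W)}
    (ha : AdWord A B n g a) (hb : AdWord A B n g b) : AdWord A B n g (a - b) := by
  rw [sub_eq_add_neg]; exact .add ha hb.neg

theorem AdWord.act {n : ℕ} {g : G} {b : TensorAlgebra k (V × W)}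
    (hb : AdWord A B n g b) (t : G) :
    AdWord A B n (t * g * t⁻¹) ((A.prod B).tensorAct t b) := by
  induction hb with
  | @of s w hw =>
    rw [tensorAct_ι]
    have : (A.prod B).ρ t (0, w) = (0, B.ρ t w) := Prod.ext (map_zero (A.ρ t)) rfl
    rw [this]
    exact .of (B.map_mem t s w hw)
  | @ad n r g v b hv _ ih =>
    rw [tensorAct_tensorAd, show t * (r * g) * t⁻¹ = (t * r * t⁻¹) * (t * g * t⁻¹) by group]
    have : (A.prod B).ρ t (v, 0) = (A.ρ t v, 0) := Prod.ext rfl (map_zero (B.ρ t))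
    rw [this]
    exact .ad (A.map_mem t r v hv) ih
  | zero n g => rw [map_zero]; exact .zero _ _
  | add _ _ ih ih' => rw [map_add]; exact .add ih ih'
  | smul c _ ih => rw [map_smul]; exact .smul c ih

/-- Being of tensor degree n + 1 is what makes the radical criterion for vanishing in the Nichols
algebra applicable. -/
theorem AdWord.exists_tensorPower {n : ℕ} {g : G} {b : TensorAlgebra k (V × W)}
    (hb : AdWord A B n g b) :
    ∃ t : ⨂[k]^(n + 1) (V × W), b = TensorPower.toTensorAlgebra t := by
  induction hb with
  | @of s w hw =>
    refine ⟨PiTensorProduct.tprod k fun _ => (0, w), ?_⟩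
    simp [TensorAlgebra.tprod_apply]
  | @ad n r g v b hv _ ih =>
    obtain ⟨t, rfl⟩ := ih
    refine ⟨cons k _ _ ((v, 0) ⊗ₜ t) - GradedMonoid.GMul.mul (A := fun n => ⨂[k]^n (V × W))
      ((A.prod B).powAct r _ t) (PiTensorProduct.tprod k fun _ : Fin 1 => (v, 0)), ?_⟩
    rw [map_sub, toTensorAlgebra_cons, tensorAd_apply, tensorAct_toTensorAlgebra]
    congr 1
    refine Eq.trans ?_ (TensorPower.toTensorAlgebra_gMul _ _).symm
    simp [TensorAlgebra.tprod_apply]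
  | zero n g => exact ⟨0, (map_zero _).symm⟩
  | add _ _ ih ih' =>
    obtain ⟨s, rfl⟩ := ih
    obtain ⟨t, rfl⟩ := ih'
    exact ⟨s + t, (map_add _ _ _).symm⟩
  | smul c _ ih =>
    obtain ⟨t, rfl⟩ := ih
    exact ⟨c • t, (map_smul _ _ _).symm⟩

theorem AdWord.nicholsMk_eq_zero_iff {n : ℕ} {g : G} {b : TensorAlgebra k (V × W)}
    (hb : AdWord A B n g b) : (A.prod B).nicholsMk b = 0 ↔ b ∈ (A.prod B).rad := by
  obtain ⟨t, rfl⟩ := hb.exists_tensorPower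
  exact (A.prod B).nicholsMk_toTensorAlgebra_eq_zero_iff t

theorem AdWord.nicholsMk_mem {n : ℕ} {g : G} {b : TensorAlgebra k (V × W)}
    (hb : AdWord A B n g b) : (A.prod B).nicholsMk b ∈ A.adPow B n := by
  induction hb with
  | @of s w hw => exact ⟨w, rfl⟩
  | @ad n r g v b hv _ ih =>
    rw [nicholsMk_tensorAd _ (inl_mem_comp hv)]
    exact Submodule.apply_mem_map₂ _ (Submodule.mem_top (x := v)) ih
  | zero n g => rw [map_zero]; exact Submodule.zero_mem _
  | add _ _ ih ih' => rw [map_add]; exact Submodule.add_mem _ ih ih'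
  | smul c _ ih => rw [map_smul]; exact Submodule.smul_mem _ _ ih

theorem adPow_le_span (A : YetterDrinfeld k G V) (B : YetterDrinfeld k G W) (n : ℕ) :
    A.adPow B n ≤
      Submodule.span k {a | ∃ g b, AdWord A B n g b ∧ (A.prod B).nicholsMk b = a} := by
  induction n with
  | zero =>
    rintro _ ⟨w, rfl⟩
    refine B.induction_comp (p := fun w => ((A.prod B).nicholsι ∘ₗ LinearMap.inr k V W) w ∈ _) w
      (fun g w hw => Submodule.subset_span ⟨g, _, .of hw, rfl⟩)
      (by rw [map_zero]; exact Submodule.zero_mem _) fun x y hx hy => ?_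
    rw [map_add]; exact Submodule.add_mem _ hx hy
  | succ n ih =>
    refine Submodule.map₂_le.2 fun v _ b hb => ?_
    refine Submodule.span_induction (p := fun b _ => ((A.prod B).ad ∘ₗ LinearMap.inl k V W) v b ∈
      Submodule.span k _) ?_ (by simp) ?_ ?_ (ih hb)
    · rintro _ ⟨g, b, hb, rfl⟩
      refine A.induction_comp (p := fun v => ((A.prod B).ad ∘ₗ LinearMap.inl k V W) v
        ((A.prod B).nicholsMk b) ∈ _) v ?_
        (by rw [map_zero, LinearMap.zero_apply]; exact Submodule.zero_mem _) fun x y hx hy => ?_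
      · intro t v hv
        exact Submodule.subset_span
          ⟨_, _, .ad hv hb, nicholsMk_tensorAd _ (inl_mem_comp hv) b⟩
      · rw [map_add, LinearMap.add_apply]; exact Submodule.add_mem _ hx hy
    · intro x y _ _ hx hy
      rw [map_add]; exact Submodule.add_mem _ hx hy
    · intro c x _ hx
      rw [map_smul]; exact Submodule.smul_mem _ _ hx

theorem exists_adWord {n : ℕ} (h : A.adPow B n ≠ ⊥) :
    ∃ g b, AdWord A B n g b ∧ b ∉ (A.prod B).rad := by
  by_contra! hcon
  refine h (eq_bot_iff.2 ((adPow_le_span A B n).trans (Submodule.span_le.2 ?_)))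
  rintro _ ⟨g, b, hb, rfl⟩
  exact hb.nicholsMk_eq_zero_iff.2 (hcon g b hb)

/-- The skew derivation attached to a functional on `V`, extended by zero to `V ⊕ W`. -/
noncomputable def skewDerL (A : YetterDrinfeld k G V) (B : YetterDrinfeld k G W)
    (ξ : Module.Dual k V) : TensorAlgebra k (V × W) →ₗ[k] TensorAlgebra k (V × W) :=
  (A.prod B).skewDer (ξ ∘ₗ LinearMap.fst k V W)

theorem IsHomFunctional.comp_fst {f : G} {ξ : Module.Dual k V} (hξ : A.IsHomFunctional f ξ)
    (B : YetterDrinfeld k G W) :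
    (A.prod B).IsHomFunctional f (ξ ∘ₗ LinearMap.fst k V W) :=
  fun h hh u hu => hξ h hh u.1 hu.1

theorem skewDerL_mem_rad {f : G} {ξ : Module.Dual k V} (hξ : A.IsHomFunctional f ξ)
    {b : TensorAlgebra k (V × W)} (hb : b ∈ (A.prod B).rad) :
    skewDerL A B ξ b ∈ (A.prod B).rad :=
  (A.prod B).skewDer_mem_rad (hξ.comp_fst B) hb

theorem AdWord.skewDerL_tensorAd {n : ℕ} {t g : G} {v : V} {b : TensorAlgebra k (V × W)}
    (hv : v ∈ A.comp t) (hb : AdWord A B n g b) (ξ : Module.Dual k V) :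
    skewDerL A B ξ ((A.prod B).tensorAd t (v, 0) b) =
      ξ v • b - ξ (A.ρ (t * g * t⁻¹) v) • (A.prod B).tensorAct t b +
        (A.prod B).tensorAd t (v, 0) (skewDerL A B (ξ ∘ₗ A.ρ t) b) :=
  (A.prod B).skewDer_tensorAd _ (inl_mem_comp hv) hb.isHomTensor

theorem AdWord.skewDerL_zero {g : G} {b : TensorAlgebra k (V × W)} (hb : AdWord A B 0 g b)
    (ξ : Module.Dual k V) : skewDerL A B ξ b = 0 := by
  generalize hn : 0 = n at hb
  induction hb with
  | of hw => simp [skewDerL, skewDer_ι]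
  | ad => cases hn
  | zero => exact map_zero _
  | add _ _ ih ih' => rw [map_add, ih hn, ih' hn, add_zero]
  | smul c _ ih => rw [map_smul, ih hn, smul_zero]

/-- Each of the three terms of the derivative of (ad v)(b) is zero or again an adjoint word one
level lower. -/
theorem AdWord.skewDerL_adWord {n : ℕ} {f g : G} {b : TensorAlgebra k (V × W)}
    (hb : AdWord A B (n + 1) g b) {ξ : Module.Dual k V} (hξ : A.IsHomFunctional f ξ) :
    AdWord A B n (f⁻¹ * g) (skewDerL A B ξ b) := by
  generalize hm : n + 1 = m at hb
  induction hb generalizing n f ξ with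
  | of => cases hm
  | @ad m t g v b hv hb ih =>
    obtain rfl : n = m := Nat.succ.inj hm
    rw [hb.skewDerL_tensorAd hv]
    refine .add (.sub ?_ ?_) ?_
    · by_cases h : t = f
      · subst h; rw [inv_mul_cancel_left]; exact .smul _ hb
      · rw [hξ t h v hv, zero_smul]; exact .zero _ _
    -- The degree of t g t⁻¹ v. If it equals f, then t b has exactly the expected degree f⁻¹ t g;
    -- otherwise the coefficient is zero.
    · by_cases h : t * g * t⁻¹ * t * (t * g * t⁻¹)⁻¹ = f
      · have := hb.act t
        rw [show t * g * t⁻¹ = f⁻¹ * (t * g) by rw [← h]; group] at this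
        rw [show t * g * t⁻¹ = f⁻¹ * (t * g) by rw [← h]; group]
        exact .smul _ this
      · rw [hξ _ h _ (A.map_mem _ _ _ hv), zero_smul]; exact .zero _ _
    · cases n with
      | zero => rw [hb.skewDerL_zero, map_zero]; exact .zero _ _
      | succ n =>
        have := AdWord.ad hv (ih (hξ.comp_ρ t) rfl)
        rwa [show t * ((t⁻¹ * f * t)⁻¹ * g) = f⁻¹ * (t * g) by group] at this
  | zero => rw [map_zero]; exact .zero _ _
  | add _ _ ih ih' => rw [map_add]; exact .add (ih hξ hm) (ih' hξ hm)
  | smul c _ ih => rw [map_smul]; exact .smul c (ih hξ hm)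

/-- A functional on W vanishes on v, so only (ad v) of the derivative of b remains. That derivative
is inductively a scalar, and (ad v) kills scalars. -/
theorem AdWord.skewDer_snd {n : ℕ} {g : G} {b : TensorAlgebra k (V × W)}
    (hb : AdWord A B n g b) (ζ : Module.Dual k W) :
    ∃ c, (A.prod B).skewDer (ζ ∘ₗ LinearMap.snd k V W) b = algebraMap k _ c ∧
      (n ≠ 0 → c = 0) := by
  induction hb generalizing ζ with
  | of hw => exact ⟨_, skewDer_ι _ _ _, fun h => (h rfl).elim⟩
  | @ad n t g v b hv hb ih =>
    refine ⟨0, ?_, fun _ => rfl⟩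
    obtain ⟨c, hc, -⟩ := ih (ζ ∘ₗ B.ρ t)
    have hc' : (A.prod B).skewDer ((ζ ∘ₗ LinearMap.snd k V W) ∘ₗ (A.prod B).ρ t) b =
      algebraMap k _ c := hc
    have h0 : ∀ h, (ζ ∘ₗ LinearMap.snd k V W) ((A.prod B).ρ h (v, 0)) = 0 := fun h => by
      change ζ (B.ρ h 0) = 0
      rw [map_zero, map_zero]
    rw [skewDer_tensorAd _ _ (inl_mem_comp hv) hb.isHomTensor, hc', tensorAd_algebraMap, h0]
    simp
  | zero n g => exact ⟨0, by simp, fun _ => rfl⟩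
  | add _ _ ih ih' =>
    obtain ⟨c, hc, h⟩ := ih ζ
    obtain ⟨c', hc', h'⟩ := ih' ζ
    exact ⟨c + c', by rw [map_add, map_add, hc, hc'], fun hn => by rw [h hn, h' hn, add_zero]⟩
  | smul r _ ih =>
    obtain ⟨c, hc, h⟩ := ih ζ
    exact ⟨r * c, by rw [map_smul, hc, map_mul, Algebra.smul_def],
      fun hn => by rw [h hn, mul_zero]⟩

theorem AdWord.algebraMapInv_eq_zero {n : ℕ} {g : G} {b : TensorAlgebra k (V × W)}
    (hb : AdWord A B n g b) : TensorAlgebra.algebraMapInv b = 0 := by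
  induction hb with
  | of => simp [TensorAlgebra.algebraMapInv]
  | ad => simp [tensorAd_apply, TensorAlgebra.algebraMapInv]
  | zero => exact map_zero _
  | add _ _ ih ih' => rw [map_add, ih, ih', add_zero]
  | smul c _ ih => rw [map_smul, ih, smul_zero]

/-- Split a functional on V ⊕ W into its two parts; above level 0 the W-part contributes nothing, so
nonvanishing is detected along V. -/
theorem AdWord.exists_skewDerL {n : ℕ} {g : G} {b : TensorAlgebra k (V × W)}
    (hb : AdWord A B (n + 1) g b) (h : b ∉ (A.prod B).rad) :
    ∃ f ξ, A.IsHomFunctional f ξ ∧ skewDerL A B ξ b ∉ (A.prod B).rad := by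
  by_contra! hcon
  refine h ((A.prod B).mem_rad_of_skewDer hb.algebraMapInv_eq_zero fun f η hη => ?_)
  have hη' : η = (η ∘ₗ LinearMap.inl k V W) ∘ₗ LinearMap.fst k V W +
      (η ∘ₗ LinearMap.inr k V W) ∘ₗ LinearMap.snd k V W := by
    refine LinearMap.ext fun u => ?_
    simp [← map_add]
  obtain ⟨c, hc, hc0⟩ := hb.skewDer_snd (η ∘ₗ LinearMap.inr k V W)
  rw [hη', skewDer_add, hc, hc0 n.succ_ne_zero, map_zero, add_zero]
  exact hcon f (η ∘ₗ LinearMap.inl k V W) fun h hh v hv => hη h hh (v, 0) (inl_mem_comp hv)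

end AdWord

/-! ### Chains of derivatives and degrees outside their associated set -/

section Chain

variable {k G V W : Type*} [Field k] [Group G] [AddCommGroup V] [Module k V]
  [AddCommGroup W] [Module k W]

/-- A descending chain of skew derivatives, of degrees given by a list, from an element of
`(ad V)^n(W)` down to an element of `W_s`, that stays nonzero in the Nichols algebra. -/
inductive DerChain (A : YetterDrinfeld k G V) (B : YetterDrinfeld k G W) (s : G) :
    ℕ → G → TensorAlgebra k (V × W) → List G → Prop
  | nil {w : TensorAlgebra k (V × W)} (hw : AdWord A B 0 s w) (h : w ∉ (A.prod B).rad) :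
      DerChain A B s 0 s w []
  | cons {n : ℕ} {f g : G} {x : TensorAlgebra k (V × W)} {l : List G} {ξ : Module.Dual k V}
      (hx : AdWord A B (n + 1) g x) (h : x ∉ (A.prod B).rad) (hξ : A.IsHomFunctional f ξ)
      (hl : DerChain A B s n (f⁻¹ * g) (skewDerL A B ξ x) l) : DerChain A B s (n + 1) g x (f :: l)

variable {A : YetterDrinfeld k G V} {B : YetterDrinfeld k G W}

theorem exists_derChain {n : ℕ} {g : G} {x : TensorAlgebra k (V × W)} (hx : AdWord A B n g x)
    (h : x ∉ (A.prod B).rad) : ∃ s l, DerChain A B s n g x l := by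
  induction n generalizing g x with
  | zero => exact ⟨g, [], .nil hx h⟩
  | succ n ih =>
    obtain ⟨f, ξ, hξ, hne⟩ := hx.exists_skewDerL h
    obtain ⟨s, l, hl⟩ := ih (hx.skewDerL_adWord hξ) hne
    exact ⟨s, f :: l, .cons hx h hξ hl⟩

theorem DerChain.notMem_rad {s : G} {n : ℕ} {g : G} {x : TensorAlgebra k (V × W)} {l : List G}
    (h : DerChain A B s n g x l) : x ∉ (A.prod B).rad := by
  cases h <;> assumption

theorem DerChain.length_eq {s : G} {n : ℕ} {g : G} {x : TensorAlgebra k (V × W)} {l : List G}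
    (h : DerChain A B s n g x l) : l.length = n := by
  induction h with
  | nil => rfl
  | cons _ _ _ _ ih => rw [List.length_cons, ih]

theorem DerChain.eq_prod_mul {s : G} {n : ℕ} {g : G} {x : TensorAlgebra k (V × W)} {l : List G}
    (h : DerChain A B s n g x l) : g = l.prod * s := by
  induction h with
  | nil => simp
  | cons _ _ _ _ ih => rw [List.prod_cons, mul_assoc, ← ih, mul_inv_cancel_left]

theorem AdWord.eq_zero_of_notMem_supp {s : G} {x : TensorAlgebra k (V × W)}
    (hx : AdWord A B 0 s x) (hs : s ∉ B.supp) : x = 0 := by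
  generalize hn : 0 = n at hx
  induction hx with
  | @of s w hw =>
    have : B.comp s = ⊥ := by simpa [supp] using hs
    rw [this, Submodule.mem_bot] at hw
    rw [hw, Prod.mk_zero_zero, map_zero]
  | ad => cases hn
  | zero => rfl
  | add _ _ ih ih' => rw [ih hs hn, ih' hs hn, add_zero]
  | smul c _ ih => rw [ih hs hn, smul_zero]

theorem DerChain.mem_supp_right {s : G} {n : ℕ} {g : G} {x : TensorAlgebra k (V × W)}
    {l : List G} (h : DerChain A B s n g x l) : s ∈ B.supp := by
  induction h with
  | nil hw h =>
    by_contra hs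
    exact h (by rw [hw.eq_zero_of_notMem_supp hs]; exact Submodule.zero_mem _)
  | cons _ _ _ _ ih => exact ih

theorem IsHomFunctional.eq_zero_of_notMem_supp {f : G} {ξ : Module.Dual k V}
    (hξ : A.IsHomFunctional f ξ) (hf : f ∉ A.supp) : ξ = 0 := by
  refine LinearMap.ext fun v => ?_
  refine A.induction_comp (p := fun v => ξ v = 0) v (fun g v hv => ?_) (map_zero _)
    fun x y hx hy => by rw [map_add, hx, hy, add_zero]
  by_cases h : g = f
  · have : A.comp f = ⊥ := by simpa [supp] using hf
    rw [h, this, Submodule.mem_bot] at hv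
    rw [hv, map_zero]
  · exact hξ g h v hv

theorem DerChain.mem_supp {s : G} {n : ℕ} {g : G} {x : TensorAlgebra k (V × W)} {l : List G}
    (h : DerChain A B s n g x l) : ∀ f ∈ l, f ∈ A.supp := by
  induction h with
  | nil => simp
  | @cons n f g x l ξ hx h hξ hl ih =>
    intro f' hf'
    rcases List.mem_cons.1 hf' with rfl | hf'
    · by_contra hs
      refine hl.notMem_rad ?_
      rw [hξ.eq_zero_of_notMem_supp hs, skewDerL, LinearMap.zero_comp, skewDer_apply, map_zero]
      exact Submodule.zero_mem _
    · exact ih f' hf'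

/-- If `x = (ad v)(y)` in the Nichols algebra, then `∂_ξ x = (ad v)(∂_{t⁻¹ ξ} y)` unless the degree
of `ξ` is `t` or `g t g⁻¹`. -/
theorem AdWord.skewDerL_sub_mem_rad {n : ℕ} {g t f : G} {x y : TensorAlgebra k (V × W)} {v : V}
    (hv : v ∈ A.comp t) (hy : AdWord A B n (t⁻¹ * g) y)
    (h : x - (A.prod B).tensorAd t (v, 0) y ∈ (A.prod B).rad) {ξ : Module.Dual k V}
    (hξ : A.IsHomFunctional f ξ) (h₁ : t ≠ f) (h₂ : g * t * g⁻¹ ≠ f) :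
    skewDerL A B ξ x - (A.prod B).tensorAd t (v, 0) (skewDerL A B (ξ ∘ₗ A.ρ t) y) ∈
      (A.prod B).rad := by
  have h' := skewDerL_mem_rad (B := B) hξ h
  have e : t * (t⁻¹ * g) * t⁻¹ * t * (t * (t⁻¹ * g) * t⁻¹)⁻¹ = g * t * g⁻¹ := by group
  rwa [map_sub, hy.skewDerL_tensorAd hv, hξ t h₁ v hv,
    hξ _ (by rwa [e]) _ (A.map_mem _ _ _ hv), zero_smul, zero_smul, sub_zero, zero_add] at h'

/-- No element of a chain is of the form `(ad v)(y)` in the Nichols algebra, if the degree of `v`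
commutes with the degrees of the chain and is not one of them. -/
theorem DerChain.false_of_sub_mem_rad {s : G} {n : ℕ} {g : G} {x : TensorAlgebra k (V × W)}
    {l : List G} (h : DerChain A B s n g x l) {t : G} (hs : Commute t s)
    (hl : ∀ f ∈ l, Commute t f) (htl : t ∉ l) {v : V} (hv : v ∈ A.comp t) {m : ℕ} (hm : n = m + 1)
    {y : TensorAlgebra k (V × W)} (hy : AdWord A B m (t⁻¹ * g) y)
    (hxy : x - (A.prod B).tensorAd t (v, 0) y ∈ (A.prod B).rad) : False := by
  induction h generalizing m y with
  | nil => cases hm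
  | @cons n f g x l ξ hx h hξ hc ih =>
    obtain rfl : n = m := Nat.succ.inj hm
    have hlt : ∀ f ∈ l, Commute t f := fun f hf => hl f (List.mem_cons_of_mem _ hf)
    have htf : t ≠ f := fun e => htl (e ▸ List.mem_cons_self)
    -- Commutation makes g t g⁻¹ = t, so the two excluded degrees of ξ coincide and t ≠ f is enough.
    have hg : Commute t g := by
      rw [(DerChain.cons hx h hξ hc).eq_prod_mul]
      exact (Commute.list_prod_right _ _ hl).mul_right hs
    have key := hy.skewDerL_sub_mem_rad hv hxy hξ htf
      (by rwa [← hg.eq, mul_inv_cancel_right])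
    cases n with
    | zero =>
      -- At the bottom y lies in W and has zero derivative along V, so the last element of the chain
      -- would vanish.
      rw [hy.skewDerL_zero, map_zero, sub_zero] at key
      exact hc.notMem_rad key
    | succ n =>
      refine ih hlt (fun h => htl (List.mem_cons_of_mem _ h)) rfl ?_ key
      have := hy.skewDerL_adWord (hξ.comp_ρ t)
      rwa [show (t⁻¹ * f * t)⁻¹ * (t⁻¹ * g) = t⁻¹ * (f⁻¹ * g) by group] at this

/-- The set of the elements `f_i` and `g_i⁻¹ f_i g_i` for a list `f_1, …, f_n`, where `g_1 = g` and
`g_{i+1} = f_i⁻¹ g_i`. -/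
def chainSet : G → List G → Set G
  | _, [] => ∅
  | g, f :: l => {f, g⁻¹ * f * g} ∪ chainSet (f⁻¹ * g) l

theorem mem_chainSet_of_mem {l : List G} {g f : G} (hf : f ∈ l) : f ∈ chainSet g l := by
  induction l generalizing g with
  | nil => cases hf
  | cons f' l ih =>
    rcases List.mem_cons.1 hf with rfl | hf
    · exact Or.inl (Or.inl rfl)
    · exact Or.inr (ih hf)

theorem commute_of_mem_chainSet {t : G} {l : List G} {g : G} (hl : ∀ f ∈ l, Commute t f)
    (hg : Commute t g) {c : G} (hc : c ∈ chainSet g l) : Commute t c := by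
  induction l generalizing g with
  | nil => cases hc
  | cons f l ih =>
    have hf := hl f List.mem_cons_self
    rcases hc with (rfl | rfl) | hc
    · exact hf
    · exact (hg.inv_right.mul_right hf).mul_right hg
    · exact ih (fun f hf => hl f (List.mem_cons_of_mem _ hf)) (hf.inv_right.mul_right hg) hc

theorem _root_.Set.encard_pair_le_two {α : Type*} (a b : α) : ({a, b} : Set α).encard ≤ 2 := by
  refine (Set.encard_insert_le _ _).trans ?_
  rw [Set.encard_singleton, one_add_one_eq_two]

theorem encard_chainSet_le (g : G) (l : List G) :
    (chainSet g l).encard ≤ ((2 * l.length : ℕ) : ℕ∞) := by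
  induction l generalizing g with
  | nil => simp [chainSet]
  | cons f l ih =>
    refine (Set.encard_union_le _ _).trans ((add_le_add (Set.encard_pair_le_two _ _) (ih _)).trans ?_)
    rw [List.length_cons, mul_add, add_comm]
    push_cast
    rfl

/-- The pair attached to the last entry f, where the current degree is f s, collapses to one element
because f commutes with s. -/
theorem encard_chainSet_add_one_le {s : G} {l : List G} (hl : l ≠ [])
    (hs : ∀ f ∈ l, Commute f s) :
    (chainSet (l.prod * s) l).encard + 1 ≤ ((2 * l.length : ℕ) : ℕ∞) := by
  induction l with
  | nil => exact (hl rfl).elim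
  | cons f l ih =>
    have e : f⁻¹ * ((f :: l).prod * s) = l.prod * s := by rw [List.prod_cons]; group
    by_cases h : l = []
    · subst h
      have hf : (([f] : List G).prod * s)⁻¹ * f * ([f].prod * s) = f := by
        have := (hs f List.mem_cons_self).eq
        rw [List.prod_singleton, mul_assoc, inv_mul_eq_iff_eq_mul, mul_assoc, this]
      rw [chainSet, hf]
      simp [chainSet, one_add_one_eq_two]
    · rw [chainSet, e]
      have := ih h fun f hf => hs f (List.mem_cons_of_mem _ hf)
      refine (add_le_add_left (Set.encard_union_le _ _) 1).trans ?_
      rw [add_assoc]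
      refine (add_le_add (Set.encard_pair_le_two _ _) this).trans ?_
      rw [List.length_cons, mul_add, add_comm]
      push_cast
      rfl

theorem exists_isHomFunctional_eq_one {t : G} {v : V} (hv : v ∈ A.comp t) (h0 : v ≠ 0) :
    ∃ ξ, A.IsHomFunctional t ξ ∧ ξ v = 1 := by
  obtain ⟨f, η, hη, hne⟩ := A.exists_isHomFunctional h0
  obtain rfl : t = f := by
    by_contra h
    exact hne (hη t h v hv)
  exact ⟨(η v)⁻¹ • η, fun h hh u hu => by rw [LinearMap.smul_apply, hη h hh u hu, smul_zero],
    inv_mul_cancel₀ hne⟩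

/-- If `(ad v)(x) = 0` for some `v` of degree `t`, where `t` does not commute with the degree `g` of
`x`, then `x` is of the form `(ad v)(y)`. -/
theorem AdWord.sub_mem_rad {n : ℕ} {g t : G} {x : TensorAlgebra k (V × W)} {v : V}
    (hv : v ∈ A.comp t) (hx : AdWord A B n g x)
    (h : (A.prod B).tensorAd t (v, 0) x ∈ (A.prod B).rad) (hg : ¬ Commute t g)
    {ξ : Module.Dual k V} (hξ : A.IsHomFunctional t ξ) (hξv : ξ v = 1) :
    x - (A.prod B).tensorAd t (v, 0) (-skewDerL A B (ξ ∘ₗ A.ρ t) x) ∈ (A.prod B).rad := by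
  have h' := skewDerL_mem_rad (B := B) hξ h
  rw [hx.skewDerL_tensorAd hv, hξv, hξ _ _ _ (A.map_mem _ _ _ hv), one_smul, zero_smul,
    sub_zero] at h'
  · rwa [map_neg, sub_neg_eq_add]
  · intro e
    refine hg ?_
    have : t * g * t * g⁻¹ * t⁻¹ = t := by
      refine Eq.trans ?_ e
      group
    rw [mul_inv_eq_iff_eq_mul, mul_inv_eq_iff_eq_mul, mul_assoc, mul_assoc] at this
    exact (mul_left_cancel this).symm

/-- The vanishing of (ad v) is passed down the chain, while commutation is recovered from the bottom
up. Failure at f, with t commuting with everything below, makes the next element of the form (ad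
v)(y), or zero at the bottom. -/
theorem DerChain.commute {s : G} {n : ℕ} {g : G} {x : TensorAlgebra k (V × W)} {l : List G}
    (h : DerChain A B s n g x l) {t : G} (ht : t ∉ chainSet g l) {v : V} (hv : v ∈ A.comp t)
    (hv0 : v ≠ 0) (had : (A.prod B).tensorAd t (v, 0) x ∈ (A.prod B).rad) :
    Commute t s ∧ ∀ f ∈ l, Commute t f := by
  obtain ⟨ξt, hξt, hξtv⟩ := exists_isHomFunctional_eq_one hv hv0
  induction h with
  | nil hw h =>
    refine ⟨by_contra fun hts => h ?_, by simp⟩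
    have := hw.sub_mem_rad hv had hts hξt hξtv
    rwa [hw.skewDerL_zero, neg_zero, map_zero, sub_zero] at this
  | @cons n f g x l ξ hx h hξ hc ih =>
    have htf : t ≠ f := fun e => ht (Or.inl (Or.inl e))
    have htg : g * t * g⁻¹ ≠ f := fun e => ht (Or.inl (Or.inr (by
      rw [Set.mem_singleton_iff, ← e]; group)))
    -- Differentiating along ξ ∘ t⁻¹, of degree t f t⁻¹, makes exactly ∂_ξ x appear inside (ad v).
    -- The boundary terms vanish since f is neither t nor g t g⁻¹.
    have hξ' : ξ = (ξ ∘ₗ A.ρ t⁻¹) ∘ₗ A.ρ t :=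
      LinearMap.ext fun u => by
        simp only [LinearMap.comp_apply, A.ρ_inv_ρ]
    have h1 : A.IsHomFunctional (t * f * t⁻¹) (ξ ∘ₗ A.ρ t⁻¹) := by
      simpa using hξ.comp_ρ t⁻¹
    have had' : (A.prod B).tensorAd t (v, 0) (skewDerL A B ξ x) ∈ (A.prod B).rad := by
      have h2 := skewDerL_mem_rad (B := B) h1 had
      rwa [hx.skewDerL_tensorAd hv, h1 t _ v hv, h1 _ _ _ (A.map_mem _ _ _ hv), zero_smul,
        zero_smul, sub_zero, zero_add, ← hξ'] at h2
      · intro e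
        refine htg ?_
        have h3 := congrArg (fun z => t⁻¹ * z * t) e
        simpa [mul_assoc] using h3
      · intro e
        refine htf ?_
        have h3 := congrArg (fun z => t⁻¹ * z * t) e
        simpa [mul_assoc] using h3
    obtain ⟨hs, hl⟩ := ih (fun h => ht (Or.inr h)) had'
    refine ⟨hs, fun f' hf' => ?_⟩
    rcases List.mem_cons.1 hf' with rfl | hf'
    · by_contra hcomm
      have hg' : Commute t (f'⁻¹ * g) := by
        rw [hc.eq_prod_mul]
        exact (Commute.list_prod_right _ _ hl).mul_right hs
      -- Since g = f' · (f'⁻¹ g) and t commutes with the second factor, commuting with g would force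
      -- commuting with f'.
      have hg : ¬ Commute t g := fun h => hcomm (by
        simpa using h.mul_right hg'.inv_right)
      have hxy := hx.sub_mem_rad hv had hg hξt hξtv
      have hy : AdWord A B n (t⁻¹ * g) (-skewDerL A B (ξt ∘ₗ A.ρ t) x) := by
        have := hx.skewDerL_adWord (hξt.comp_ρ t)
        rw [inv_mul_cancel, one_mul] at this
        exact this.neg
      have key := hy.skewDerL_sub_mem_rad hv hxy hξ htf htg
      cases n with
      | zero =>
        rw [hy.skewDerL_zero, map_zero, sub_zero] at key
        exact hc.notMem_rad key
      | succ n =>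
        refine hc.false_of_sub_mem_rad hs hl
          (fun h => ht (Or.inr (mem_chainSet_of_mem h))) hv rfl ?_ key
        have := hy.skewDerL_adWord (hξ.comp_ρ t)
        rwa [show (t⁻¹ * f' * t)⁻¹ * (t⁻¹ * g) = t⁻¹ * (f'⁻¹ * g) by group] at this
    · exact hl f' hf'

end Chain

/-! ### Propagation along orbits of the inner group -/

section Closure

variable {k G V : Type*} [Field k] [Group G] [AddCommGroup V] [Module k V]

/-- A subset of the support whose complement commutes with it is a union of orbits of the inner
group. -/
theorem smul_mem_iff_of_commute (A : YetterDrinfeld k G V) {L : Set A.supp}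
    (hL : ∀ r ∉ L, ∀ c ∈ L, Commute (r : G) c) {σ : Equiv.Perm A.supp} (hσ : σ ∈ Inn A.supp)
    (r : A.supp) : σ r ∈ L ↔ r ∈ L := by
  induction hσ using Subgroup.closure_induction generalizing r with
  | one => rfl
  | mul σ τ _ _ ihσ ihτ => rw [Equiv.Perm.mul_apply, ihσ, ihτ]
  | inv σ _ ih =>
    have : σ (σ⁻¹ r) = r := σ.apply_symm_apply r
    rw [← ih, this]
  | mem σ hσ =>
    obtain ⟨q, rfl⟩ := hσ
    have hq : ((Rack.act' q r : A.supp) : G) = q * r * (q : G)⁻¹ := rfl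
    have hcomm : Commute (q : G) r → Rack.act' q r = r := fun h => Subtype.ext (by
      rw [hq, h.eq, mul_inv_cancel_right])
    have hcomm' : Commute (q : G) (Rack.act' q r : A.supp) → Rack.act' q r = r := fun h =>
      hcomm (by
        rw [hq] at h
        have := (Commute.refl (q : G)).inv_right.mul_right
          (h.mul_right (Commute.refl (q : G)))
        simpa [mul_assoc] using this)
    -- If exactly one of r and q r q⁻¹ lay in L, then q would be on the other side of L from one of
    -- them and commute with it, forcing q r q⁻¹ = r.
    constructor
    · intro h
      by_contra hr
      by_cases hqL : q ∈ L
      · rw [hcomm (hL r hr q hqL).symm] at h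
        exact hr h
      · rw [hcomm' (hL q hqL _ h)] at h
        exact hr h
    · intro h
      by_contra hr
      by_cases hqL : q ∈ L
      · exact hr (by rwa [hcomm' (hL _ hr q hqL).symm])
      · exact hr (by rwa [hcomm (hL q hqL _ h)])

/-- L absorbs the whole inner orbit of f. When s exchanges two orbits, a point of the other orbit
outside L commutes with s, so it equals its own image in the orbit of f, which is inside L. -/
theorem mem_of_commute {W : Type*} [AddCommGroup W] [Module k W] (A : YetterDrinfeld k G V)
    (B : YetterDrinfeld k G W)
    (hsupp : IsIndecomposable A.supp ∨
      ∃ Y₁ Y₂ : Set A.supp, IsInnOrbit Y₁ ∧ IsInnOrbit Y₂ ∧ Disjoint Y₁ Y₂ ∧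
        Y₁ ∪ Y₂ = Set.univ ∧
        ∀ x ∈ B.supp, A.conjSupp x '' Y₁ = Y₂ ∧ A.conjSupp x '' Y₂ = Y₁)
    {L : Set A.supp} (hL : ∀ r ∉ L, ∀ c ∈ L, Commute (r : G) c) {s : G} (hs : s ∈ B.supp)
    (hLs : ∀ r ∉ L, Commute (r : G) s) {f : A.supp} (hf : f ∈ L) (r : A.supp) : r ∈ L := by
  rcases hsupp with h | ⟨Y₁, Y₂, ⟨y₁, hy₁⟩, ⟨y₂, hy₂⟩, -, hY, hconj⟩
  · obtain ⟨σ, rfl⟩ := h.exists_smul_eq f r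
    exact (A.smul_mem_iff_of_commute hL σ.2 f).2 hf
  · have orbit : ∀ (y : A.supp) (Y : Set A.supp), Y = MulAction.orbit (Inn A.supp) y → f ∈ Y →
        Y ⊆ L := by
      rintro y _ rfl ⟨σ, hσ⟩ _ ⟨τ, rfl⟩
      refine (A.smul_mem_iff_of_commute hL τ.2 y).2 ((A.smul_mem_iff_of_commute hL σ.2 y).1 ?_)
      have : (σ : Equiv.Perm A.supp) y = f := hσ
      rwa [this]
    have swap : ∀ Y Y' : Set A.supp, A.conjSupp s '' Y' = Y → Y ⊆ L → r ∈ Y' → r ∈ L := by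
      intro Y Y' he hYL hr
      by_contra hrL
      have h1 : A.conjSupp s r = r := Subtype.ext (by
        change s * r * s⁻¹ = r
        rw [← (hLs r hrL).eq, mul_inv_cancel_right])
      exact hrL (hYL (he ▸ ⟨r, hr, h1⟩))
    obtain ⟨h12, h21⟩ := hconj s hs
    rcases (hY ▸ Set.mem_univ f : f ∈ Y₁ ∪ Y₂) with hf' | hf' <;>
      rcases (hY ▸ Set.mem_univ r : r ∈ Y₁ ∪ Y₂) with hr | hr
    · exact orbit y₁ Y₁ hy₁ hf' hr
    · exact swap Y₁ Y₂ h21 (orbit y₁ Y₁ hy₁ hf') hr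
    · exact swap Y₂ Y₁ h12 (orbit y₂ Y₂ hy₂ hf') hr
    · exact orbit y₂ Y₂ hy₂ hf' hr

end Closure

end YetterDrinfeld

/-! ### The covering of the support and the cardinality bounds -/

open YetterDrinfeld in
theorem supp_subset_chainSet {k G V W : Type*} [Field k] [Group G] [AddCommGroup V] [Module k V]
    [AddCommGroup W] [Module k W] (A : YetterDrinfeld k G V) (B : YetterDrinfeld k G W)
    (m : ℕ) (hm : 1 ≤ m)
    (hsupp : IsIndecomposable A.supp ∨
      ∃ Y₁ Y₂ : Set A.supp, IsInnOrbit Y₁ ∧ IsInnOrbit Y₂ ∧ Disjoint Y₁ Y₂ ∧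
        Y₁ ∪ Y₂ = Set.univ ∧
        ∀ x ∈ B.supp, A.conjSupp x '' Y₁ = Y₂ ∧ A.conjSupp x '' Y₂ = Y₁)
    (hne : A.adPow B m ≠ ⊥) (hzero : A.adPow B (m + 1) = ⊥) :
    ∃ (l : List G) (s : G), l.length = m ∧ (∀ f ∈ l, f ∈ A.supp) ∧ s ∈ B.supp ∧
      A.supp ⊆ chainSet (l.prod * s) l := by
  obtain ⟨g, x, hx, hxr⟩ := exists_adWord hne
  obtain ⟨s, l, h⟩ := exists_derChain hx hxr
  obtain rfl := h.eq_prod_mul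
  refine ⟨l, s, h.length_eq, h.mem_supp, h.mem_supp_right, ?_⟩
  have key : ∀ t ∈ A.supp, t ∉ chainSet (l.prod * s) l →
      Commute t s ∧ ∀ f ∈ l, Commute t f := by
    intro t ht htl
    obtain ⟨v, hv, hv0⟩ := (Submodule.ne_bot_iff _).1 ht
    refine h.commute htl hv hv0 ((AdWord.ad hv hx).nicholsMk_eq_zero_iff.1 ?_)
    have := (AdWord.ad hv hx).nicholsMk_mem
    rwa [hzero, Submodule.mem_bot] at this
  -- Here m ≥ 1 enters: the chain has an entry, so the part of the support inside the chain set is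
  -- nonempty.
  obtain ⟨f, hf⟩ : ∃ f, f ∈ l := List.exists_mem_of_length_pos (by rw [h.length_eq]; exact hm)
  intro r hr
  refine mem_of_commute A B hsupp (L := {r | (r : G) ∈ chainSet (l.prod * s) l}) ?_
    h.mem_supp_right (fun r hr => (key r r.2 hr).1) (f := ⟨f, h.mem_supp f hf⟩)
    (mem_chainSet_of_mem hf) ⟨r, hr⟩
  intro r hr c hc
  obtain ⟨hs, hl⟩ := key r r.2 hr
  exact commute_of_mem_chainSet hl ((Commute.list_prod_right _ _ hl).mul_right hs) hc

theorem mainTheorem8 {k G V W : Type*} [Field k] [Group G] [AddCommGroup V] [Module k V]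
    [AddCommGroup W] [Module k W] (A : YetterDrinfeld k G V) (B : YetterDrinfeld k G W)
    (m : ℕ) (hm : 1 ≤ m)
    (hsupp : IsIndecomposable A.supp ∨
      ∃ Y₁ Y₂ : Set A.supp, IsInnOrbit Y₁ ∧ IsInnOrbit Y₂ ∧ Disjoint Y₁ Y₂ ∧
        Y₁ ∪ Y₂ = Set.univ ∧
        ∀ x ∈ B.supp, A.conjSupp x '' Y₁ = Y₂ ∧ A.conjSupp x '' Y₂ = Y₁)
    (hne : A.adPow B m ≠ ⊥) (hzero : A.adPow B (m + 1) = ⊥) :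
    ((∀ r ∈ A.supp, ∀ s ∈ B.supp, Commute r s) →
        A.supp.encard ≤ ((2 * m - 1 : ℕ) : ℕ∞)) ∧
      (¬ (∀ r ∈ A.supp, ∀ s ∈ B.supp, Commute r s) →
        A.supp.encard ≤ ((2 * m : ℕ) : ℕ∞)) := by
  obtain ⟨l, s, rfl, hl, hs, hsub⟩ := supp_subset_chainSet A B m hm hsupp hne hzero
  refine ⟨fun hcomm => ?_, fun _ =>
    (Set.encard_le_encard hsub).trans (YetterDrinfeld.encard_chainSet_le _ _)⟩
  have hl0 : l ≠ [] := by rintro rfl; simp at hm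
  have h := YetterDrinfeld.encard_chainSet_add_one_le hl0 fun f hf => hcomm f (hl f hf) s hs
  -- The bound is proved as |C| + 1 ≤ 2m and the finite 1 is cancelled; m ≥ 1 makes the truncated
  -- subtraction 2m − 1 exact.
  refine (Set.encard_le_encard hsub).trans
    ((ENat.add_le_add_iff_right ENat.one_ne_top).1 (h.trans ?_))
  norm_cast
  omega
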